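/- **Theorem 1 (Wick's theorem).** Let $\mathcal H$ be a complex Hilbert space with a Hilbert basis $(e_i)_{i\in I}$, and let $\eta=+1$ (bosons) or $\eta=-1$ (fermions). Let $\mathcal F=\bigoplus_{k\ge 0}P_\eta\mathcal H^{\otimes k}$ be the corresponding Fock space, where $P_\eta=\frac1{k!}\sum_{\sigma\in\mathfrak S_k}\eta^{\epsilon(\sigma)}U_\sigma$ is the (anti)symmetrizer and $\epsilon(\sigma)\in\{0,1\}$ is the parity of $\sigma$. For $v\in\mathcal H$ let $a(v)$ and $a^\dagger(v)$ be the annihilation and creation operators, acting on the dense subspace $\mathcal F_0\subset\mathcal F$ of vectors with a bounded number of particles: for $f$ in the $(k+1)$-particle space, $a(v)f$ is $\sqrt{k+1}$ times the contraction of the first tensor factor of $f$ with $\langle v|$; for $f$ in the $k$-particle space, $a^\dagger(v)f=\sqrt{k+1}\,P_\eta(v\otimes f)$. Write $a_i=a(e_i)$. Let $\nu_i\in\mathbb R$ $(i\in I)$ be such that $e^{-\sum_i\nu_i a_i^\dagger a_i}$ (spectral calculus) is a bounded trace-class operator, let $Z$ be its trace, and let $$\rho=\frac1Z\,e^{-\sum_i\nu_i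 a_i^\dagger a_i}.$$ For a linear operator $O:\mathcal F_0\to\mathcal F_0$ write $\langle O\rangle=\operatorname{tr}(\rho\, O)$ whenever $\rho\, O$ extends to a trace-class operator on $\mathcal F$. (i) Let $k\ge 0$, $N=2k$, and let $b_1,\dots,b_N$ be finite linear combinations of operators $a(v)$, $a^\dagger(v)$ with $v\in\mathcal H$ arbitrary (creation and annihilation operators in any basis). Then all expectations $\langle b_ib_j\rangle$ and $\langle b_1\cdots b_N\rangle$ exist, and $$\langle b_1\cdots b_N\rangle=\sum_{\sigma}\eta^{\epsilon(\sigma)}\,\langle b_{\sigma(1)}b_{\sigma(2)}\rangle\,\langle b_{\sigma(3)}b_{\sigma(4)}\rangle\cdots\langle b_{\sigma(N-1)}b_{\sigma(N)}\rangle,$$ where the sum is over the contractions of order $N$, that is, the permutations $\sigma\in\mathfrak S_N$ with $\sigma(1)<\sigma(3)<\dots<\sigma(2k-1)$ and $\sigma(2i-1)<\sigma(2i)$ for $i=1,\dots,k$. (ii) Let $k\ge 0$, let $v_1,\dots,v_k\in\mathcal H$ be orthonormal (for instance distinct basis vectors $e_i$), and let $N_i=a^\dagger(v_i)a(v_i)$.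 Then $\langle N_1\cdots N_k\rangle$ exists and equals the permanent (if $\eta=1$) or the determinant (if $\eta=-1$) of the matrix $\big(\langle a^\dagger(v_i)a(v_j)\rangle\big)_{1\le i,j\le k}$. -/

import Mathlib

open scoped InnerProductSpace

noncomputable section

namespace WickFock

/-- The sign `η ^ ε(σ)`, where `ε(σ) = 0` if `σ` is even and `ε(σ) = 1` if `σ` is odd.
The statistics `η : ℤˣ` is `1` for bosons and `-1` for fermions. -/
def statSign (η : ℤˣ) {k : ℕ} (σ : Equiv.Perm (Fin k)) : ℂ :=
  if Equiv.Perm.sign σ = 1 then 1 else ((η : ℤ) : ℂ)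

theorem statSign_mul (η : ℤˣ) {k : ℕ} (σ τ : Equiv.Perm (Fin k)) :
    statSign η (σ * τ) = statSign η σ * statSign η τ := by
  unfold statSign
  rcases Int.units_eq_one_or η with rfl | rfl <;>
  rcases Int.units_eq_one_or (Equiv.Perm.sign σ) with h | h <;>
  rcases Int.units_eq_one_or (Equiv.Perm.sign τ) with h' | h' <;>
  simp [h, h']

/-- Labels of the product basis vectors `e (x 0) ⊗ ⋯ ⊗ e (x (k - 1))` of the tensor powers
of a Hilbert space with Hilbert basis `e` indexed by `ι`, for all `k`. -/
abbrev Conf (ι : Type*) := Σ k : ℕ, (Fin k → ι)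

/-- The orthogonal direct sum over `k` of the Hilbert tensor powers `H^{⊗ k}`, each vector being
given by its coordinates in the product basis; the tensor `u_1 ⊗ ⋯ ⊗ u_k` has the coordinates
`x ↦ ∏ j, ⟪e (x j), u_j⟫`. -/
abbrev FullFock (ι : Type*) := lp (fun _ : Conf ι => ℂ) 2

/-- The Fock space: the direct sum of the symmetric (`η = 1`) or antisymmetric (`η = -1`)
tensor powers. -/
def Fock (η : ℤˣ) (ι : Type*) : Submodule ℂ (FullFock ι) where
  carrier := {f | ∀ (k : ℕ) (x : Fin k → ι) (σ : Equiv.Perm (Fin k)),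
    f ⟨k, x ∘ σ⟩ = statSign η σ * f ⟨k, x⟩}
  zero_mem' := by intro k x σ; simp
  add_mem' := by
    intro f g hf hg k x σ
    simp only [lp.coeFn_add, Pi.add_apply, hf k x σ, hg k x σ, mul_add]
  smul_mem' := by
    intro c f hf k x σ
    simp only [lp.coeFn_smul, Pi.smul_apply, hf k x σ, smul_eq_mul]
    ring

theorem Fock.isClosed (η : ℤˣ) (ι : Type*) : IsClosed (Fock η ι : Set (FullFock ι)) := by
  have hc : ∀ p : Conf ι, Continuous fun f : FullFock ι => f p := fun p =>
    (continuous_apply p).comp (lp.uniformContinuous_coe).continuous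
  have : (Fock η ι : Set (FullFock ι)) =
      ⋂ (k : ℕ) (x : Fin k → ι) (σ : Equiv.Perm (Fin k)),
        {f : FullFock ι | f ⟨k, x ∘ σ⟩ = statSign η σ * f ⟨k, x⟩} := by
    ext f
    simp only [Set.mem_iInter, Set.mem_ofPred_eq]
    rfl
  rw [this]
  exact isClosed_iInter fun k => isClosed_iInter fun x => isClosed_iInter fun σ =>
    isClosed_eq (hc _) (continuous_const.mul (hc _))

instance (η : ℤˣ) (ι : Type*) : CompleteSpace (Fock η ι) :=
  (Fock.isClosed η ι).completeSpace_coe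

/-- The vectors with a bounded number of particles, that is, the algebraic direct sum of the
(anti)symmetric tensor powers. The ladder operators act on this dense subspace. -/
def FinFock (η : ℤˣ) (ι : Type*) : Submodule ℂ (Fock η ι) where
  carrier := {f | ∃ K : ℕ, ∀ (k : ℕ) (x : Fin k → ι), K < k → (f : FullFock ι) ⟨k, x⟩ = 0}
  zero_mem' := ⟨0, by intros; simp⟩
  add_mem' := by
    rintro f g ⟨K, hK⟩ ⟨L, hL⟩
    refine ⟨max K L, fun k x h => ?_⟩
    simp [hK k x (lt_of_le_of_lt (le_max_left _ _) h),
      hL k x (lt_of_le_of_lt (le_max_right _ _) h)]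
  smul_mem' := by
    rintro c f ⟨K, hK⟩
    exact ⟨K, fun k x h => by simp [hK k x h]⟩

/-- The coordinates of a vector with a bounded number of particles. -/
def coord {η : ℤˣ} {ι : Type*} (f : FinFock η ι) : Conf ι → ℂ :=
  ((f : Fock η ι) : FullFock ι)

section Coord

variable {η : ℤˣ} {ι : Type*}

theorem ext_coord {f g : FinFock η ι} (h : ∀ k x, coord f ⟨k, x⟩ = coord g ⟨k, x⟩) :
    f = g := by
  apply Subtype.ext
  apply Subtype.ext
  apply lp.ext
  funext p
  obtain ⟨k, x⟩ := p
  exact h k x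

theorem coord_add (f g : FinFock η ι) (p : Conf ι) :
    coord (f + g) p = coord f p + coord g p := rfl

theorem coord_smul (c : ℂ) (f : FinFock η ι) (p : Conf ι) :
    coord (c • f) p = c * coord f p := rfl

theorem coord_perm (f : FinFock η ι) (k : ℕ) (x : Fin k → ι) (σ : Equiv.Perm (Fin k)) :
    coord f ⟨k, x ∘ σ⟩ = statSign η σ * coord f ⟨k, x⟩ :=
  f.1.2 k x σ

theorem summable_sq (f : FinFock η ι) : Summable fun p => ‖coord f p‖ ^ 2 := by
  have h := (lp.memℓp (f : Fock η ι).1).summable (by norm_num)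
  simpa [coord] using h

theorem summable_sector (f : FinFock η ι) (k : ℕ) :
    Summable fun x : Fin k → ι => ‖coord f ⟨k, x⟩‖ ^ 2 :=
  (summable_sq f).comp_injective (i := fun x : Fin k → ι => (⟨k, x⟩ : Conf ι))
    (fun _ _ h => eq_of_heq (Sigma.mk.inj h).2)

theorem memLp_of_sectors (g : Conf ι → ℂ) (K : ℕ) (h0 : ∀ k x, K < k → g ⟨k, x⟩ = 0)
    (hs : ∀ k, Summable fun x : Fin k → ι => ‖g ⟨k, x⟩‖ ^ 2) : Memℓp g 2 := by
  apply memℓp_gen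
  have : Summable fun p : Conf ι => ‖g p‖ ^ 2 := by
    rw [summable_sigma_of_nonneg (fun _ => by positivity)]
    refine ⟨hs, summable_of_ne_finset_zero (s := Finset.range (K + 1)) fun k hk => ?_⟩
    have hk' : K < k := by simpa using hk
    simp [h0 k _ hk']
  simpa using this

/-- A vector with a bounded number of particles, from its coordinates. -/
def mkFinFock (g : Conf ι → ℂ)
    (hp : ∀ k (x : Fin k → ι) (σ : Equiv.Perm (Fin k)), g ⟨k, x ∘ σ⟩ = statSign η σ * g ⟨k, x⟩)
    (h0 : ∃ K : ℕ, ∀ k x, K < k → g ⟨k, x⟩ = 0)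
    (hs : ∀ k, Summable fun x : Fin k → ι => ‖g ⟨k, x⟩‖ ^ 2) : FinFock η ι :=
  ⟨⟨⟨g, memLp_of_sectors g h0.choose h0.choose_spec hs⟩, hp⟩, h0⟩

/-- The (anti)symmetrization `(1 / k!) ∑ σ, η ^ ε(σ) U_σ` on each tensor power. -/
def symmetrize (η : ℤˣ) (g : Conf ι → ℂ) : Conf ι → ℂ := fun p =>
  ((p.1.factorial : ℂ))⁻¹ * ∑ σ : Equiv.Perm (Fin p.1), statSign η σ * g ⟨p.1, p.2 ∘ σ⟩

theorem statSign_mul_self {k : ℕ} (σ : Equiv.Perm (Fin k)) :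
    statSign η σ * statSign η σ = 1 := by
  unfold statSign
  rcases Int.units_eq_one_or η with rfl | rfl <;> split_ifs <;> simp

theorem symmetrize_perm (g : Conf ι → ℂ) (k : ℕ) (x : Fin k → ι) (σ : Equiv.Perm (Fin k)) :
    symmetrize η g ⟨k, x ∘ σ⟩ = statSign η σ * symmetrize η g ⟨k, x⟩ := by
  simp only [symmetrize]
  rw [mul_left_comm]
  congr 1
  rw [Finset.mul_sum]
  refine Fintype.sum_equiv (Equiv.mulLeft σ) _ _ fun τ => ?_
  simp only [Equiv.coe_mulLeft, statSign_mul]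
  rw [← mul_assoc, ← mul_assoc, statSign_mul_self, one_mul]
  rfl

theorem symmetrize_summable (g : Conf ι → ℂ) (k : ℕ)
    (hs : Summable fun x : Fin k → ι => ‖g ⟨k, x⟩‖ ^ 2) :
    Summable fun x : Fin k → ι => ‖symmetrize η g ⟨k, x⟩‖ ^ 2 := by
  have hmem : ∀ σ : Equiv.Perm (Fin k),
      Memℓp (fun x : Fin k → ι => statSign η σ * g ⟨k, x ∘ σ⟩) 2 := by
    intro σ
    refine Memℓp.const_mul (𝕜 := ℂ) ?_ _
    apply memℓp_gen
    have h := hs.comp_injective (i := fun x : Fin k → ι => x ∘ σ)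
      (σ.surjective.injective_comp_right)
    simpa [Function.comp_def] using h
  have h1 := Memℓp.const_mul (𝕜 := ℂ)
    (Memℓp.finsetSum (E := fun _ : Fin k → ι => ℂ) Finset.univ fun σ _ => hmem σ)
    ((k.factorial : ℂ))⁻¹
  have h2 := h1.summable (by norm_num)
  simpa [symmetrize, Finset.sum_apply] using h2

end Coord

section Ladder

variable {ι H : Type*} [NormedAddCommGroup H] [InnerProductSpace ℂ H]

/-- Coordinates of `a(v) f`: on the `(k+1)`-particle sector, `√(k+1)` times the contraction
of the first tensor factor with `⟨v|`. -/
def annihFun (e : HilbertBasis ι ℂ H) (v : H) (f : Conf ι → ℂ) : Conf ι → ℂ := fun p =>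
  (Real.sqrt (p.1 + 1) : ℂ) * ∑' y : ι, ⟪v, e y⟫_ℂ * f ⟨p.1 + 1, Fin.cons y p.2⟩

/-- Coordinates of `√(k+1) v ⊗ f`, for `f` in the `k`-particle sector. -/
def tensorFun (e : HilbertBasis ι ℂ H) (v : H) (f : Conf ι → ℂ) : Conf ι → ℂ
  | ⟨0, _⟩ => 0
  | ⟨k + 1, x⟩ => (Real.sqrt (k + 1) : ℂ) * (⟪e (x 0), v⟫_ℂ * f ⟨k, Fin.tail x⟩)

theorem summable_inner_sq (e : HilbertBasis ι ℂ H) (v : H) :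
    Summable fun y => ‖⟪e y, v⟫_ℂ‖ ^ 2 :=
  e.orthonormal.inner_products_summable v

theorem summable_slice {η : ℤˣ} (f : FinFock η ι) (k : ℕ) (x : Fin k → ι) :
    Memℓp (fun y : ι => coord f ⟨k + 1, Fin.cons y x⟩) 2 := by
  apply memℓp_gen
  have h := (summable_sector f (k + 1)).comp_injective
    (i := fun y : ι => (Fin.cons y x : Fin (k + 1) → ι))
    (Fin.cons_left_injective (α := fun _ => ι) x)
  simpa [Function.comp_def] using h

theorem hasSum_contract {η : ℤˣ} (e : HilbertBasis ι ℂ H) (v : H) (f : FinFock η ι) (k : ℕ)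
    (x : Fin k → ι) :
    HasSum (fun y : ι => ⟪v, e y⟫_ℂ * coord f ⟨k + 1, Fin.cons y x⟩)
      ⟪e.repr v, (⟨_, summable_slice f k x⟩ : lp (fun _ : ι => ℂ) 2)⟫_ℂ := by
  refine (lp.hasSum_inner (𝕜 := ℂ) (e.repr v)
    (⟨_, summable_slice f k x⟩ : lp (fun _ : ι => ℂ) 2)).congr_fun fun y => ?_
  rw [RCLike.inner_apply, HilbertBasis.repr_apply_apply, inner_conj_symm, mul_comm]

theorem annihFun_perm {η : ℤˣ} (e : HilbertBasis ι ℂ H) (v : H) (f : FinFock η ι) (k : ℕ)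
    (x : Fin k → ι) (σ : Equiv.Perm (Fin k)) :
    annihFun e v (coord f) ⟨k, x ∘ σ⟩ = statSign η σ * annihFun e v (coord f) ⟨k, x⟩ := by
  have key : ∀ y : ι, coord f ⟨k + 1, Fin.cons y (x ∘ σ)⟩
      = statSign η σ * coord f ⟨k + 1, Fin.cons y x⟩ := by
    intro y
    have h1 : (Fin.cons y (x ∘ σ) : Fin (k + 1) → ι) =
        (Fin.cons y x : Fin (k + 1) → ι) ∘ (Equiv.Perm.decomposeFin.symm (0, σ)) := by
      funext j
      refine Fin.cases ?_ (fun j => ?_) j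
      · simp
      · simp
    rw [h1, coord_perm]
    simp [statSign]
  simp only [annihFun, key]
  rw [mul_left_comm, ← tsum_mul_left (a := statSign η σ)]
  congr 1
  refine tsum_congr fun y => ?_
  ring

theorem annihFun_summable {η : ℤˣ} (e : HilbertBasis ι ℂ H) (v : H) (f : FinFock η ι) (k : ℕ) :
    Summable fun x : Fin k → ι => ‖annihFun e v (coord f) ⟨k, x⟩‖ ^ 2 := by
  have h1 : Summable fun q : (Fin k → ι) × ι => ‖coord f ⟨k + 1, Fin.cons q.2 q.1⟩‖ ^ 2 := by
    have h := (summable_sector f (k + 1)).comp_injective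
      (i := fun q : (Fin k → ι) × ι => (Fin.cons q.2 q.1 : Fin (k + 1) → ι)) (by
        rintro ⟨x, y⟩ ⟨x', y'⟩ h
        obtain ⟨h1, h2⟩ := Fin.cons_injective2 (α := fun _ => ι) h
        simp only at h1 h2
        rw [h1, h2])
    simpa [Function.comp_def] using h
  refine Summable.of_nonneg_of_le (fun _ => by positivity) (fun x => ?_)
    (h1.prod.mul_left ((k + 1 : ℝ) * ‖v‖ ^ 2))
  simp only [annihFun]
  rw [(hasSum_contract e v f k x).tsum_eq, norm_mul, mul_pow, mul_assoc]
  have hk : ‖(Real.sqrt (k + 1) : ℂ)‖ ^ 2 = (k + 1 : ℝ) := by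
    rw [Complex.norm_real, Real.norm_eq_abs, sq_abs, Real.sq_sqrt (by positivity)]
  rw [hk]
  refine mul_le_mul_of_nonneg_left ?_ (by positivity)
  have h2 := norm_inner_le_norm (𝕜 := ℂ) (e.repr v)
    (⟨_, summable_slice f k x⟩ : lp (fun _ : ι => ℂ) 2)
  have h3 : ‖(⟨_, summable_slice f k x⟩ : lp (fun _ : ι => ℂ) 2)‖ ^ 2 =
      ∑' y : ι, ‖coord f ⟨k + 1, Fin.cons y x⟩‖ ^ 2 := by
    have := lp.norm_rpow_eq_tsum (p := 2) (by norm_num)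
      (⟨_, summable_slice f k x⟩ : lp (fun _ : ι => ℂ) 2)
    simpa using this
  rw [LinearIsometryEquiv.norm_map] at h2
  calc _ ≤ (‖v‖ * ‖(⟨_, summable_slice f k x⟩ : lp (fun _ : ι => ℂ) 2)‖) ^ 2 :=
        pow_le_pow_left₀ (norm_nonneg _) h2 2
    _ = _ := by rw [mul_pow, h3]

theorem tensorFun_summable {η : ℤˣ} (e : HilbertBasis ι ℂ H) (v : H) (f : FinFock η ι) (k : ℕ) :
    Summable fun x : Fin k → ι => ‖tensorFun e v (coord f) ⟨k, x⟩‖ ^ 2 := by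
  cases k with
  | zero => exact Summable.of_finite
  | succ k =>
    have h1 := (summable_inner_sq e v).mul_of_nonneg (summable_sector f k)
      (fun _ => by positivity) (fun _ => by positivity)
    have h2 := h1.comp_injective
      (i := fun x : Fin (k + 1) → ι => (x 0, Fin.tail x)) (by
        intro x x' h
        simp only [Prod.mk.injEq] at h
        rw [← Fin.cons_self_tail x, ← Fin.cons_self_tail x', h.1, h.2])
    refine (h2.mul_left (‖(Real.sqrt (k + 1) : ℂ)‖ ^ 2)).congr fun x => ?_
    simp only [tensorFun, Function.comp_apply, norm_mul, mul_pow]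

/-- The annihilation operator `a(v)`. -/
def annihilation (η : ℤˣ) (e : HilbertBasis ι ℂ H) (v : H) : Module.End ℂ (FinFock η ι) where
  toFun f := mkFinFock (annihFun e v (coord f)) (annihFun_perm e v f)
    (by
      obtain ⟨K, hK⟩ := f.2
      refine ⟨K, fun k x h => ?_⟩
      have : ∀ y : ι, coord f ⟨k + 1, Fin.cons y x⟩ = 0 := fun y => hK _ _ (by omega)
      simp [annihFun, this])
    (annihFun_summable e v f)
  map_add' f g := by
    refine ext_coord fun k x => ?_
    change annihFun e v (coord (f + g)) ⟨k, x⟩ =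
      annihFun e v (coord f) ⟨k, x⟩ + annihFun e v (coord g) ⟨k, x⟩
    simp only [annihFun, coord_add, mul_add]
    rw [(hasSum_contract e v f k x).summable.tsum_add (hasSum_contract e v g k x).summable, mul_add]
  map_smul' c f := by
    refine ext_coord fun k x => ?_
    change annihFun e v (coord (c • f)) ⟨k, x⟩ = c * annihFun e v (coord f) ⟨k, x⟩
    simp only [annihFun, coord_smul]
    rw [mul_left_comm, ← tsum_mul_left (a := c)]
    congr 1
    refine tsum_congr fun y => ?_
    ring

/-- The creation operator `a†(v)`, the adjoint of `a(v)`: the (anti)symmetrization of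
`√(k+1) v ⊗ f` on the `k`-particle sector. -/
def creation (η : ℤˣ) (e : HilbertBasis ι ℂ H) (v : H) : Module.End ℂ (FinFock η ι) where
  toFun f := mkFinFock (symmetrize η (tensorFun e v (coord f))) (symmetrize_perm _)
    (by
      obtain ⟨K, hK⟩ := f.2
      refine ⟨K + 1, fun k x h => ?_⟩
      obtain ⟨k, rfl⟩ : ∃ m, k = m + 1 := ⟨k - 1, by omega⟩
      have : ∀ x : Fin k → ι, coord f ⟨k, x⟩ = 0 := fun x => hK _ _ (by omega)
      simp [symmetrize, tensorFun, this])
    (fun k => symmetrize_summable _ k (tensorFun_summable e v f k))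
  map_add' f g := by
    refine ext_coord fun k x => ?_
    change symmetrize η (tensorFun e v (coord (f + g))) ⟨k, x⟩ =
      symmetrize η (tensorFun e v (coord f)) ⟨k, x⟩ + symmetrize η (tensorFun e v (coord g)) ⟨k, x⟩
    simp only [symmetrize, ← mul_add, ← Finset.sum_add_distrib]
    congr 1
    refine Finset.sum_congr rfl fun σ _ => ?_
    cases k with
    | zero => simp [tensorFun]
    | succ k => simp only [tensorFun, coord_add]; ring
  map_smul' c f := by
    refine ext_coord fun k x => ?_
    change symmetrize η (tensorFun e v (coord (c • f))) ⟨k, x⟩ =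
      c * symmetrize η (tensorFun e v (coord f)) ⟨k, x⟩
    simp only [symmetrize]
    rw [mul_left_comm]
    congr 1
    rw [Finset.mul_sum]
    refine Finset.sum_congr rfl fun σ _ => ?_
    cases k with
    | zero => simp [tensorFun]
    | succ k => simp only [tensorFun, coord_smul]; ring

/-- `b` is a finite linear combination of creation and annihilation operators of arbitrary
one-particle vectors (in particular, of the vectors of any basis of `H`). -/
def IsLadderCombination (η : ℤˣ) (e : HilbertBasis ι ℂ H) (b : Module.End ℂ (FinFock η ι)) : Prop :=
  b ∈ Submodule.span ℂ (Set.range (creation η e) ∪ Set.range (annihilation η e))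

end Ladder

/-- The bounded operator `T` is trace-class with trace `z`: for every Hilbert basis, the diagonal
matrix elements of `T` form an (absolutely) summable family with sum `z`. On a complex Hilbert
space, summability in every Hilbert basis characterizes the trace-class operators. -/
def HasTrace {E : Type*} [NormedAddCommGroup E] [InnerProductSpace ℂ E] (T : E →L[ℂ] E) (z : ℂ) :
    Prop :=
  ∀ (s : Set E) (f : HilbertBasis s ℂ E), HasSum (fun i => ⟪f i, T (f i)⟫_ℂ) z

section Gaussian

variable {ι H : Type*} [NormedAddCommGroup H] [InnerProductSpace ℂ H]

/-- `G = exp (-∑ i, ν i a†_i a_i)` in the sense of the spectral calculus, where `a_i = a(e_i)`: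
every joint eigenvector of the number operators `a†_i a_i`, with eigenvalues `n i`, is an
eigenvector of `G` with eigenvalue `exp (-∑ i, ν i n i)`. (These eigenvectors, the Fock states,
span a dense subspace, so that this determines the bounded operator `G`.) -/
def IsExpNegNumber (η : ℤˣ) (e : HilbertBasis ι ℂ H) (ν : ι → ℝ)
    (G : Fock η ι →L[ℂ] Fock η ι) : Prop :=
  ∀ (n : ι →₀ ℕ) (ψ : FinFock η ι),
    (∀ i, creation η e (e i) (annihilation η e (e i) ψ) = (n i : ℂ) • ψ) →
    G (ψ : Fock η ι) = (Real.exp (-(n.sum fun i m => ν i * m)) : ℂ) • (ψ : Fock η ι)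

/-- `ρ` is the Gaussian density matrix `Z⁻¹ exp (-∑ i, ν i a†_i a_i)`, with
`Z = tr exp (-∑ i, ν i a†_i a_i)`; in particular the exponential is trace-class. -/
def IsGaussianDensity (η : ℤˣ) (e : HilbertBasis ι ℂ H) (ν : ι → ℝ)
    (ρ : Fock η ι →L[ℂ] Fock η ι) : Prop :=
  ∃ (G : Fock η ι →L[ℂ] Fock η ι) (Z : ℂ),
    IsExpNegNumber η e ν G ∧ HasTrace G Z ∧ ρ = Z⁻¹ • G

end Gaussian

section Expectation

variable {η : ℤˣ} {ι : Type*}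

/-- `tr (ρ O)` exists and equals `z`: the densely defined operator `ρ O` extends to a trace-class
operator on the Fock space, with trace `z`. -/
def HasExpectation (ρ : Fock η ι →L[ℂ] Fock η ι) (O : Module.End ℂ (FinFock η ι)) (z : ℂ) : Prop :=
  ∃ T : Fock η ι →L[ℂ] Fock η ι,
    (∀ ψ : FinFock η ι, T (ψ : Fock η ι) = ρ (O ψ : Fock η ι)) ∧ HasTrace T z

open Classical in
/-- The expectation `⟨O⟩ = tr (ρ O)` (and `0` if it does not exist). -/
def expectation (ρ : Fock η ι →L[ℂ] Fock η ι) (O : Module.End ℂ (FinFock η ι)) : ℂ :=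
  if h : ∃ z, HasExpectation ρ O z then h.choose else 0

end Expectation

/-- The index `2 i - 1` (counting from `1`) of the first element of the `i`-th pair. -/
def pairFst {k : ℕ} (i : Fin k) : Fin (2 * k) := ⟨2 * i, by omega⟩

/-- The index `2 i` (counting from `1`) of the second element of the `i`-th pair. -/
def pairSnd {k : ℕ} (i : Fin k) : Fin (2 * k) := ⟨2 * i + 1, by omega⟩

open Classical in
/-- The contractions of order `2 k`: the permutations `σ` with
`σ(1) < σ(3) < ⋯ < σ(2k-1)` and `σ(2i-1) < σ(2i)` for all `i`. -/
def contractions (k : ℕ) : Finset (Equiv.Perm (Fin (2 * k))) :=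
  Finset.univ.filter fun σ =>
    (∀ i j : Fin k, i < j → σ (pairFst i) < σ (pairFst j)) ∧
    (∀ i : Fin k, σ (pairFst i) < σ (pairSnd i))

end WickFock

end

/-! Write `y i = exp (-ν i)` and let `sym p` be the (anti)symmetrized product basis vector with
label `p = (k, x)`. The vectors `sym p` are overcomplete, but `⟪sym p, f⟫` is the coordinate of
`f` with label `p`, so that `f = ∑ p, ⟪sym p, f⟫ sym p` (`hasSum_sym`) and traces can be computed
as `∑ p, ⟪sym p, T (sym p)⟫`, without passing to occupation numbers and their normalizations. The
vectors `sym p` are joint eigenvectors of the number operators, hence `exp (-∑ i, ν i a†_i a_i)`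
multiplies `sym p` by `weight y p = ∏ j, y (x j)`, and its being trace-class means that
`∑ p, weight y p * ‖sym p‖²` converges, with sum `Z` (`IsExpNegNumber.hasSum_weight`).

*Existence of the expectations.* For a polynomial `O` in the ladder operators, `ρ O` is
`Z⁻¹ ∑ p, weight y p |sym p⟩⟨O† sym p|`, and `‖O† sym p‖` grows at most polynomially in the number
of particles. It is therefore enough that all moments of the particle number are finite
(`summable_moment`). More is true: `∑ p, r ^ |p| * weight y p * ‖sym p‖²` converges for some
`r > 1` (`exists_summable_pow_mul_weight`). Cut the factor `r ^ |p|` off at `K` particles.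
Cyclicity of the resulting weighted trace, applied to `a†_i a_i`, bounds the occupation of the
mode `i` by `c y i U`, with `U` the truncated sum and `c` independent of `K`. Since `∑ i, y i`
converges (it is the contribution of one particle), the mean number of particles, `U` being the
total mass, is bounded uniformly in `K`; hence the sectors with few particles carry at least half
of `U`, which bounds `U` uniformly in `K`.

*Wick's recursion.* The state `ω = ⟨·⟩` satisfies `ω (a†_i X) = y i ω (X a†_i)` and
`ω (a_i X) = (y i)⁻¹ ω (X a_i)`. Moving `c = a†_i` or `c = a_i` through `b_1 ⋯ b_n` with the
(anti)commutation relations and back to the front by cyclicity gives, for `n` odd,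
`ω (c b_1 ⋯ b_n) = ∑ j, η ^ (j - 1) ω (c b_j) ω (b_1 ⋯ b̂_j ⋯ b_n)` (`wickRecursion_of_cyclic`);
the factor `1 - η y i` or `1 - η (y i)⁻¹` to divide by is nonzero because `y i < 1` for bosons,
again by convergence of the sum. Both sides are continuous and (anti)linear in the vector that `c`
depends on, so the recursion extends to all ladder operators and their linear combinations
(`IsGaussianState.wickRecursion`).

*Conclusion.* A contraction pairs the first point with one of the others, say the `j`-th of
these, and restricts to a contraction of the remaining points, with relative sign `η ^ (j - 1)`;
hence the sum over contractions satisfies the same recursion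
(`wickSum_succ`, `wick_of_recursion`). For number operators of orthonormal modes, normal ordering
costs only the sign `η ^ (k choose 2)`; in `⟨a†(u_1) ⋯ a†(u_k) a(w_1) ⋯ a(w_k)⟩` only the pairs
`a†(u_i) a(w_j)` contribute, and the recursion becomes the Laplace expansion of a permanent or
determinant along its first row (`normal_ordered_of_recursion`). -/

noncomputable section

namespace WickFock

/-! ### Permutations, contractions and signs -/

/-- The statistics `η = ±1` as a complex number. -/
def eta (η : ℤˣ) : ℂ := ((η : ℤ) : ℂ)

theorem eta_mul_self (η : ℤˣ) : eta η * eta η = 1 := by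
  rcases Int.units_eq_one_or η with rfl | rfl <;> simp [eta]

theorem eta_pow_even (η : ℤˣ) {n : ℕ} (h : Even n) : eta η ^ n = 1 := by
  obtain ⟨m, rfl⟩ := h
  rw [pow_add, ← mul_pow, eta_mul_self, one_pow]

theorem eta_pow_odd (η : ℤˣ) {n : ℕ} (h : Odd n) : eta η ^ n = eta η := by
  obtain ⟨m, rfl⟩ := h
  rw [pow_succ, eta_pow_even η ⟨m, two_mul m⟩, one_mul]

theorem statSign_one (η : ℤˣ) (n : ℕ) : statSign η (1 : Equiv.Perm (Fin n)) = 1 := by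
  simp [statSign]

theorem statSign_inv (η : ℤˣ) {n : ℕ} (σ : Equiv.Perm (Fin n)) :
    statSign η σ⁻¹ = statSign η σ := by
  simp [statSign]

theorem star_statSign (η : ℤˣ) {n : ℕ} (σ : Equiv.Perm (Fin n)) :
    (starRingEnd ℂ) (statSign η σ) = statSign η σ := by
  unfold statSign
  split_ifs <;> simp

theorem star_eta (η : ℤˣ) : (starRingEnd ℂ) (eta η) = eta η := by
  simp [eta]

/-- The permutation sending `0` to `j` and acting on the remaining points like `τ`, after the
order-preserving identification of the complement of `j` with `Fin n`. -/
def insertPerm {n : ℕ} (j : Fin (n + 1)) (τ : Equiv.Perm (Fin n)) : Equiv.Perm (Fin (n + 1)) :=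
  j.cycleRange.symm * Equiv.Perm.decomposeFin.symm (0, τ)

@[simp]
theorem insertPerm_zero {n : ℕ} (j : Fin (n + 1)) (τ : Equiv.Perm (Fin n)) :
    insertPerm j τ 0 = j := by
  simp [insertPerm, Equiv.Perm.mul_apply]

@[simp]
theorem insertPerm_succ {n : ℕ} (j : Fin (n + 1)) (τ : Equiv.Perm (Fin n)) (m : Fin n) :
    insertPerm j τ m.succ = j.succAbove (τ m) := by
  simp [insertPerm, Equiv.Perm.mul_apply]

theorem statSign_insertPerm (η : ℤˣ) {n : ℕ} (j : Fin (n + 1)) (τ : Equiv.Perm (Fin n)) :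
    statSign η (insertPerm j τ) = eta η ^ (j : ℕ) * statSign η τ := by
  rw [insertPerm, statSign_mul]
  congr 1
  · rw [show (j.cycleRange.symm : Equiv.Perm (Fin (n + 1))) = (j.cycleRange)⁻¹ from rfl,
      statSign_inv, statSign, Fin.sign_cycleRange]
    rcases Nat.even_or_odd (j : ℕ) with h | h
    · rw [eta_pow_even η h, h.neg_one_pow]; simp
    · rw [eta_pow_odd η h, h.neg_one_pow]; simp [eta]
  · simp [statSign]

theorem insertPerm_bijective (n : ℕ) :
    Function.Bijective fun q : Fin (n + 1) × Equiv.Perm (Fin n) => insertPerm q.1 q.2 := by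
  rw [Fintype.bijective_iff_injective_and_card]
  constructor
  · rintro ⟨j, τ⟩ ⟨j', τ'⟩ h
    have h' : ∀ m, insertPerm j τ m = insertPerm j' τ' m := fun m =>
      congrArg (fun σ : Equiv.Perm (Fin (n + 1)) => σ m) h
    have h0 : j = j' := by simpa using h' 0
    subst h0
    have h1 : τ = τ' := by
      ext m
      have := h' m.succ
      simp only [insertPerm_succ] at this
      rw [Fin.succAbove_right_injective this]
    rw [h1]
  · simp [Fintype.card_perm, Nat.factorial_succ]

theorem sum_perm_succ {M : Type*} [AddCommMonoid M] {n : ℕ} (F : Equiv.Perm (Fin (n + 1)) → M) :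
    ∑ σ, F σ = ∑ j, ∑ τ, F (insertPerm j τ) := by
  rw [← Fintype.sum_prod_type']
  exact (Function.Bijective.sum_comp (insertPerm_bijective n) F).symm

/-- The sum `∑ σ, η ^ ε(σ) ∏ i, A i (σ i)`, that is, the permanent or the determinant. -/
def etaDet (η : ℤˣ) {n : ℕ} (A : Fin n → Fin n → ℂ) : ℂ :=
  ∑ σ : Equiv.Perm (Fin n), statSign η σ * ∏ i, A i (σ i)

/-- Laplace expansion along the first row, for the permanent and the determinant. -/
theorem etaDet_succ (η : ℤˣ) {n : ℕ} (A : Fin (n + 1) → Fin (n + 1) → ℂ) :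
    etaDet η A = ∑ j : Fin (n + 1), eta η ^ (j : ℕ) * A 0 j *
      etaDet η (fun a b => A a.succ (j.succAbove b)) := by
  rw [etaDet, sum_perm_succ]
  refine Finset.sum_congr rfl fun j _ => ?_
  rw [etaDet, Finset.mul_sum]
  refine Finset.sum_congr rfl fun τ _ => ?_
  rw [statSign_insertPerm, Fin.prod_univ_succ]
  simp only [insertPerm_zero, insertPerm_succ]
  ring

theorem etaDet_eq_permanent_or_det (η : ℤˣ) {n : ℕ} (A : Fin n → Fin n → ℂ) :
    etaDet η A = if η = 1 then (Matrix.of A).permanent else (Matrix.of A).det := by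
  split_ifs with h
  · subst h
    rw [← Matrix.permanent_transpose]
    simp [etaDet, statSign, Matrix.permanent]
  · obtain rfl : η = -1 := (Int.units_eq_one_or η).resolve_left h
    rw [← Matrix.det_transpose, Matrix.det_apply']
    refine Finset.sum_congr rfl fun σ _ => ?_
    congr 1
    rcases Int.units_eq_one_or (Equiv.Perm.sign σ) with h' | h' <;> simp [statSign, h']

/-- The right-hand side of Wick's theorem, for the pair expectations `g a b`. -/
def wickSum (η : ℤˣ) (k : ℕ) (g : Fin (2 * k) → Fin (2 * k) → ℂ) : ℂ :=
  ∑ σ ∈ contractions k, statSign η σ * ∏ i : Fin k, g (σ (pairFst i)) (σ (pairSnd i))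

/-- A contraction fixes `0`: the least point is the first element of its pair, and the pairs are
ordered by their first elements. -/
theorem apply_zero_of_mem_contractions {k : ℕ} {σ : Equiv.Perm (Fin (2 * (k + 1)))}
    (h : σ ∈ contractions (k + 1)) : σ 0 = 0 := by
  simp only [contractions, Finset.mem_filter, Finset.mem_univ, true_and] at h
  obtain ⟨h1, h2⟩ := h
  have hz : (0 : Fin (2 * (k + 1))) = pairFst (0 : Fin (k + 1)) := by ext; simp [pairFst]
  have h3 : ∀ i : Fin (k + 1), σ 0 ≤ σ (pairFst i) := by
    intro i
    rcases eq_or_ne i 0 with rfl | hi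
    · rw [← hz]
    · rw [hz]; exact (h1 0 i (Fin.pos_of_ne_zero hi)).le
  obtain ⟨m, hm⟩ := σ.surjective 0
  have h4 : σ 0 ≤ σ m := by
    have hlt : (m : ℕ) / 2 < k + 1 := by omega
    rcases Nat.mod_two_eq_zero_or_one m with hm2 | hm2
    · have : m = pairFst (⟨m / 2, hlt⟩ : Fin (k + 1)) := by ext; simp [pairFst]; omega
      rw [this]; exact h3 _
    · have : m = pairSnd (⟨m / 2, hlt⟩ : Fin (k + 1)) := by ext; simp [pairSnd]; omega
      rw [this]; exact (h3 _).trans (h2 _).le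
  rw [hm] at h4
  exact le_antisymm h4 (Fin.zero_le _)

/-- The permutation that pairs `0` with `j + 1` and, on the remaining points, is `τ`. -/
def pairCons {k : ℕ} (j : Fin (2 * k + 1)) (τ : Equiv.Perm (Fin (2 * k))) :
    Equiv.Perm (Fin (2 * (k + 1))) :=
  insertPerm (n := 2 * k + 1) 0 (insertPerm j τ)

/-- The order embedding of `Fin (2 * k)` whose range misses `0` and `j + 1`. -/
def skipPair {k : ℕ} (j : Fin (2 * k + 1)) (a : Fin (2 * k)) : Fin (2 * (k + 1)) :=
  (j.succAbove a).succ

theorem skipPair_lt_skipPair {k : ℕ} (j : Fin (2 * k + 1)) {a b : Fin (2 * k)} :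
    skipPair j a < skipPair j b ↔ a < b :=
  Fin.succ_lt_succ_iff.trans Fin.succAbove_lt_succAbove_iff

theorem pairCons_pairFst_zero {k : ℕ} (j : Fin (2 * k + 1)) (τ : Equiv.Perm (Fin (2 * k))) :
    pairCons j τ (pairFst 0) = 0 := by
  have h : (pairFst (0 : Fin (k + 1))) = (0 : Fin (2 * k + 2)) := by ext; simp [pairFst]
  rw [h]
  exact insertPerm_zero _ _

theorem pairCons_pairSnd_zero {k : ℕ} (j : Fin (2 * k + 1)) (τ : Equiv.Perm (Fin (2 * k))) :
    pairCons j τ (pairSnd 0) = (j.succ : Fin (2 * k + 2)) := by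
  have h : (pairSnd (0 : Fin (k + 1))) = (0 : Fin (2 * k + 1)).succ := by ext; simp [pairSnd]
  rw [h]
  refine (insertPerm_succ _ _ _).trans ?_
  rw [insertPerm_zero, Fin.zero_succAbove]

theorem pairCons_succ_succ {k : ℕ} (j : Fin (2 * k + 1)) (τ : Equiv.Perm (Fin (2 * k)))
    (m : Fin (2 * k)) : pairCons j τ (m.succ.succ : Fin (2 * k + 2)) = skipPair j (τ m) := by
  refine (insertPerm_succ _ _ _).trans ?_
  rw [insertPerm_succ, Fin.zero_succAbove]
  rfl

theorem pairCons_pairFst_succ {k : ℕ} (j : Fin (2 * k + 1)) (τ : Equiv.Perm (Fin (2 * k)))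
    (i : Fin k) : pairCons j τ (pairFst i.succ) = skipPair j (τ (pairFst i)) := by
  rw [← pairCons_succ_succ]
  congr 1

theorem pairCons_pairSnd_succ {k : ℕ} (j : Fin (2 * k + 1)) (τ : Equiv.Perm (Fin (2 * k)))
    (i : Fin k) : pairCons j τ (pairSnd i.succ) = skipPair j (τ (pairSnd i)) := by
  rw [← pairCons_succ_succ]
  congr 1

theorem pairCons_mem_contractions {k : ℕ} (j : Fin (2 * k + 1)) (τ : Equiv.Perm (Fin (2 * k))) :
    pairCons j τ ∈ contractions (k + 1) ↔ τ ∈ contractions k := by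
  simp only [contractions, Finset.mem_filter, Finset.mem_univ, true_and, Fin.forall_fin_succ,
    pairCons_pairFst_zero, pairCons_pairSnd_zero, pairCons_pairFst_succ, pairCons_pairSnd_succ,
    skipPair_lt_skipPair, Fin.succ_lt_succ_iff]
  constructor
  · rintro ⟨⟨-, h1⟩, -, h2⟩
    exact ⟨fun i => (h1 i).2, h2⟩
  · rintro ⟨h1, h2⟩
    exact ⟨⟨⟨fun h => absurd h (lt_irrefl _), fun _ _ => Fin.succ_pos _⟩,
      fun i => ⟨fun h => absurd h (by simp), h1 i⟩⟩, Fin.succ_pos _, h2⟩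

/-- Expansion of the sum over contractions with respect to the partner of the first operator. -/
theorem wickSum_succ (η : ℤˣ) (k : ℕ) (g : Fin (2 * (k + 1)) → Fin (2 * (k + 1)) → ℂ) :
    wickSum η (k + 1) g = ∑ j : Fin (2 * k + 1), eta η ^ (j : ℕ) *
      g 0 (j.succ : Fin (2 * k + 2)) *
      wickSum η k (fun a b => g (skipPair j a) (skipPair j b)) := by
  classical
  have h0 : wickSum η (k + 1) g = ∑ σ : Equiv.Perm (Fin (2 * (k + 1))),
      if σ ∈ contractions (k + 1) then
        statSign η σ * ∏ i : Fin (k + 1), g (σ (pairFst i)) (σ (pairSnd i)) else 0 := by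
    rw [← Finset.sum_filter]
    exact Finset.sum_congr (by ext; simp) fun _ _ => rfl
  refine h0.trans ((sum_perm_succ (n := 2 * k + 1) _).trans ?_)
  rw [Fin.sum_univ_succ]
  refine (congrArg₂ (· + ·) ?_ (Finset.sum_eq_zero ?_)).trans (add_zero _)
  · refine (sum_perm_succ _).trans (Finset.sum_congr rfl fun j _ => ?_)
    rw [wickSum, Finset.mul_sum]
    have h1 : ∀ τ : Equiv.Perm (Fin (2 * k)), (if pairCons j τ ∈ contractions (k + 1) then
        statSign η (pairCons j τ) * ∏ i : Fin (k + 1),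
          g (pairCons j τ (pairFst i)) (pairCons j τ (pairSnd i)) else 0) =
        if τ ∈ contractions k then eta η ^ (j : ℕ) * g 0 (j.succ : Fin (2 * k + 2)) *
          (statSign η τ * ∏ i : Fin k, g (skipPair j (τ (pairFst i))) (skipPair j (τ (pairSnd i))))
        else 0 := by
      intro τ
      have h2 : statSign η (pairCons j τ) = eta η ^ (j : ℕ) * statSign η τ := by
        refine (statSign_insertPerm _ _ _).trans ?_
        rw [statSign_insertPerm, Fin.val_zero, pow_zero, one_mul]
      rw [Fin.prod_univ_succ, h2]
      simp only [pairCons_mem_contractions, pairCons_pairFst_zero, pairCons_pairSnd_zero,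
        pairCons_pairFst_succ, pairCons_pairSnd_succ]
      congr 1
      ring
    refine (Finset.sum_congr rfl fun τ _ => h1 τ).trans ?_
    rw [← Finset.sum_filter]
    exact Finset.sum_congr (by ext; simp) fun _ _ => rfl
  · intro j _
    refine Finset.sum_eq_zero fun τ _ => if_neg fun h => ?_
    have h3 := apply_zero_of_mem_contractions h
    exact Fin.succ_ne_zero j ((insertPerm_zero j.succ τ).symm.trans h3)

theorem natAdd_succAbove_castAdd {n m : ℕ} (j : Fin (m + 1)) (i : Fin n) :
    (Fin.natAdd n j : Fin (n + m + 1)).succAbove (Fin.castAdd m i) = Fin.castAdd (m + 1) i := by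
  rw [Fin.succAbove_of_castSucc_lt]
  · rfl
  · simp [Fin.lt_def]; omega

theorem natAdd_succAbove_natAdd {n m : ℕ} (j : Fin (m + 1)) (i : Fin m) :
    (Fin.natAdd n j : Fin (n + m + 1)).succAbove (Fin.natAdd n i) =
      Fin.natAdd n (j.succAbove i) := by
  ext
  simp only [Fin.succAbove, Fin.lt_def, Fin.val_castSucc, Fin.val_natAdd, Nat.add_lt_add_iff_left]
  split_ifs <;> rfl

theorem append_comp_natAdd_succAbove {R : Type*} {n m : ℕ} (u : Fin n → R) (w : Fin (m + 1) → R)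
    (j : Fin (m + 1)) : (Fin.append (n := m + 1) u w : Fin (n + m + 1) → R) ∘
      (Fin.natAdd n j : Fin (n + m + 1)).succAbove = Fin.append u (w ∘ j.succAbove) := by
  funext a
  refine Fin.addCases (fun i => ?_) (fun i => ?_) a
  · rw [Function.comp_apply, natAdd_succAbove_castAdd, Fin.append_left, Fin.append_left]
  · rw [Function.comp_apply, natAdd_succAbove_natAdd, Fin.append_right, Fin.append_right]
    rfl

/-! ### Wick's theorem for a linear functional on an algebra -/

section Algebra

variable {R : Type*} [Ring R] [Algebra ℂ R]

/-- Moving `c` from the right to the left of a product: every factor contributes a sign and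
a scalar (anti)commutator term in which that factor is omitted. -/
theorem prod_mul_comm_of_commutator (η : ℤˣ) (c : R) :
    ∀ {n : ℕ} (b : Fin (n + 1) → R) (s : Fin (n + 1) → ℂ),
      (∀ j, b j * c = eta η • (c * b j) + s j • 1) →
      (List.ofFn b).prod * c = eta η ^ (n + 1) • (c * (List.ofFn b).prod) +
        ∑ j : Fin (n + 1), (eta η ^ (n + (j : ℕ)) * s j) • (List.ofFn (b ∘ j.succAbove)).prod := by
  intro n
  induction n with
  | zero =>
    intro b s h
    simp [h 0]
  | succ n ih =>
    intro b s h
    have h1 := ih (fun i => b i.succ) (fun i => s i.succ) (fun j => h j.succ)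
    have h2 : (List.ofFn b).prod = b 0 * (List.ofFn fun i => b i.succ).prod := by
      rw [List.ofFn_succ, List.prod_cons]
    have h3 : ∀ j : Fin (n + 1), (List.ofFn (b ∘ j.succ.succAbove)).prod =
        b 0 * (List.ofFn ((fun i => b i.succ) ∘ j.succAbove)).prod := by
      intro j
      rw [List.ofFn_succ, List.prod_cons]
      simp [Function.comp_def]
    rw [h2, mul_assoc, h1, Fin.sum_univ_succ (n := n + 1), mul_add, mul_smul_comm, ← mul_assoc,
      h 0, Finset.mul_sum]
    simp only [h3, Fin.succAbove_zero, Fin.val_zero, Fin.val_succ, mul_smul_comm]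
    rw [add_mul, smul_add, ← add_assoc]
    congr 1
    · simp only [smul_mul_assoc, one_mul, smul_smul, mul_assoc, ← pow_succ]
      rfl
    · refine Finset.sum_congr rfl fun j _ => ?_
      congr 2
      rw [show n + 1 + ((j : ℕ) + 1) = n + j + 2 by ring, pow_add (eta η) _ 2, sq, eta_mul_self,
        mul_one]

/-- The recursion behind Wick's theorem, for the expectation `ω (c b_1 ⋯ b_n)` with `n` odd:
sum over the partner `b_j` of `c`. -/
def WickRecursion (η : ℤˣ) (ω : R →ₗ[ℂ] ℂ) {n : ℕ} (c : R) (b : Fin (n + 1) → R) : Prop :=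
  ω (c * (List.ofFn b).prod) = ∑ j : Fin (n + 1),
    eta η ^ (j : ℕ) * ω (c * b j) * ω (List.ofFn (b ∘ j.succAbove)).prod

/-- A functional that is cyclic up to a factor `κ ≠ η` with respect to `c` satisfies the recursion:
move `c` around the trace through the other factors. -/
theorem wickRecursion_of_cyclic (η : ℤˣ) (ω : R →ₗ[ℂ] ℂ) (h1 : ω 1 = 1) {n : ℕ} (hn : Even n)
    (c : R) (b : Fin (n + 1) → R) (s : Fin (n + 1) → ℂ)
    (hcomm : ∀ j, b j * c = eta η • (c * b j) + s j • 1) (κ : ℂ) (hκ : 1 - eta η * κ ≠ 0)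
    (hcyc : ω (c * (List.ofFn b).prod) = κ * ω ((List.ofFn b).prod * c))
    (hcyc' : ∀ j, ω (c * b j) = κ * ω (b j * c)) : WickRecursion η ω c b := by
  have h2 : ∀ j, (1 - eta η * κ) * ω (c * b j) = κ * s j := by
    intro j
    have h3 := hcyc' j
    rw [hcomm j] at h3
    simp only [map_add, map_smul, h1, smul_eq_mul, mul_one] at h3
    linear_combination h3
  have h4 := hcyc
  rw [prod_mul_comm_of_commutator η c b s hcomm, eta_pow_odd η hn.add_one] at h4
  simp only [map_add, map_smul, map_sum, smul_eq_mul] at h4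
  have h5 : κ * ∑ j : Fin (n + 1), eta η ^ (n + (j : ℕ)) * s j *
      ω (List.ofFn (b ∘ j.succAbove)).prod = (1 - eta η * κ) * ∑ j : Fin (n + 1),
      eta η ^ (j : ℕ) * ω (c * b j) * ω (List.ofFn (b ∘ j.succAbove)).prod := by
    rw [Finset.mul_sum, Finset.mul_sum]
    refine Finset.sum_congr rfl fun j _ => ?_
    rw [pow_add, eta_pow_even η hn, one_mul]
    linear_combination (-(eta η ^ (j : ℕ)) * ω (List.ofFn (b ∘ j.succAbove)).prod) * h2 j
  refine mul_left_cancel₀ hκ ?_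
  rw [← h5]
  linear_combination h4

/-- The recursion yields the sum over all contractions. -/
theorem wick_of_recursion (η : ℤˣ) (ω : R →ₗ[ℂ] ℂ) (h1 : ω 1 = 1) (V : Set R)
    (h : ∀ n, Even n → ∀ c ∈ V, ∀ b : Fin (n + 1) → R, (∀ j, b j ∈ V) → WickRecursion η ω c b) :
    ∀ (k : ℕ) (b : Fin (2 * k) → R), (∀ j, b j ∈ V) →
      ω (List.ofFn b).prod = wickSum η k fun i j => ω (b i * b j) := by
  intro k
  induction k with
  | zero =>
    intro b _
    have : contractions 0 = Finset.univ := by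
      ext σ
      simp [contractions]
    simp only [wickSum, this]
    have h2 : ∀ σ : Equiv.Perm (Fin (2 * 0)), statSign η σ = 1 := fun σ => by
      have : σ = 1 := Equiv.ext fun x => Fin.elim0 x
      rw [this, statSign_one]
    simp [h1, h2]
  | succ k ih =>
    intro b hb
    rw [wickSum_succ]
    have h2 := h (2 * k) (even_two_mul k) (b 0) (hb 0) (fun j => b (j.succ : Fin (2 * k + 2)))
      (fun j => hb _)
    have h3 : (List.ofFn b).prod =
        b 0 * (List.ofFn fun j : Fin (2 * k + 1) => b (j.succ : Fin (2 * k + 2))).prod := by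
      refine (congrArg List.prod (List.ofFn_succ (n := 2 * k + 1) (f := b))).trans ?_
      rw [List.prod_cons]
    rw [h3, h2]
    refine Finset.sum_congr rfl fun j _ => ?_
    exact congrArg _ (ih _ fun a => hb _)

/-- The expectation of a normally ordered product as a permanent or determinant. The sign
`η ^ (n choose 2)` reverses the order of the factors `w`. -/
theorem normal_ordered_of_recursion (η : ℤˣ) (ω : R →ₗ[ℂ] ℂ) (h1 : ω 1 = 1) (V W : Set R)
    (h : ∀ n, Even n → ∀ c ∈ V, ∀ b : Fin (n + 1) → R, (∀ j, b j ∈ V ∪ W) → WickRecursion η ω c b)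
    (h0 : ∀ u ∈ V, ∀ u' ∈ V, ω (u * u') = 0) :
    ∀ (n : ℕ) (u w : Fin n → R), (∀ j, u j ∈ V) → (∀ j, w j ∈ W) →
      ω ((List.ofFn u).prod * (List.ofFn w).prod) =
        eta η ^ n.choose 2 * etaDet η fun i j => ω (u i * w j) := by
  intro n
  induction n with
  | zero =>
    intro u w _ _
    simp [etaDet, h1, statSign]
  | succ n ih =>
    intro u w hu hw
    have h2 := h (n + n) ⟨n, rfl⟩ (u 0) (hu 0)
      (Fin.append (m := n) (n := n + 1) (fun i => u i.succ) w) (fun j => by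
      refine Fin.addCases (m := n) (n := n + 1) (fun i => ?_) (fun i => ?_) j
      · rw [Fin.append_left]; exact Or.inl (hu _)
      · rw [Fin.append_right]; exact Or.inr (hw _))
    have h3 : (List.ofFn u).prod * (List.ofFn w).prod = u 0 *
        (List.ofFn (Fin.append (m := n) (n := n + 1) (fun i => u i.succ) w :
          Fin (n + n + 1) → R)).prod := by
      rw [List.ofFn_succ, List.prod_cons, mul_assoc, ← List.prod_append]
      congr 2
      exact (List.ofFn_fin_append _ _).symm
    rw [h3, h2, etaDet_succ, Finset.mul_sum]
    refine (Fin.sum_univ_add (a := n) (b := n + 1) _).trans ?_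
    refine (congrArg₂ (· + ·) (Finset.sum_eq_zero fun i _ => ?_) rfl).trans (zero_add _) |>.trans ?_
    · rw [Fin.append_left, h0 _ (hu _) _ (hu _), mul_zero, zero_mul]
    · refine Finset.sum_congr rfl fun j _ => ?_
      rw [append_comp_natAdd_succAbove, Fin.append_right, Fin.val_natAdd]
      have h4 : (List.ofFn (Fin.append (fun i => u i.succ) (w ∘ j.succAbove))).prod =
          (List.ofFn fun i => u i.succ).prod * (List.ofFn (w ∘ j.succAbove)).prod := by
        rw [List.ofFn_fin_append, List.prod_append]
      rw [h4, ih (fun i => u i.succ) (w ∘ j.succAbove) (fun _ => hu _) (fun _ => hw _),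
        Nat.choose_succ_succ, Nat.choose_one_right]
      simp only [pow_add, Function.comp_apply]
      ring

end Algebra

attribute [local instance] InnerProductSpace.toInner

/-- Makes the inner product of the Hilbert space structure the one that is found first; Mathlib's
instance through `CStarModule` agrees with it only after unfolding. -/
local instance instInnerFock (η : ℤˣ) (ι : Type*) : Inner ℂ (Fock η ι) :=
  InnerProductSpace.toInner

/-! ### The symmetrized product basis of the Fock space -/

theorem summable_mul_of_sq {α : Type*} {f g : α → ℂ} (hf : Summable fun a => ‖f a‖ ^ 2)
    (hg : Summable fun a => ‖g a‖ ^ 2) : Summable fun a => f a * g a := by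
  refine Summable.of_norm_bounded (hf.add hg) fun a => ?_
  rw [norm_mul]
  nlinarith [sq_nonneg (‖f a‖ - ‖g a‖), sq_nonneg (‖f a‖), sq_nonneg (‖g a‖)]

section Basis

variable {ι : Type*}

open Classical in
/-- The (anti)symmetrization `P_η (e (x 0) ⊗ ⋯ ⊗ e (x (k - 1)))` of the product basis vector with
label `p = (k, x)`, in the full Fock space. -/
def symFull (η : ℤˣ) (p : Conf ι) : FullFock ι :=
  (p.1.factorial : ℂ)⁻¹ • ∑ σ : Equiv.Perm (Fin p.1),
    statSign η σ • lp.single (E := fun _ : Conf ι => ℂ) 2 (⟨p.1, p.2 ∘ σ⟩ : Conf ι) (1 : ℂ)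

theorem mk_eq_mk_iff {k : ℕ} {x z : Fin k → ι} : (⟨k, x⟩ : Conf ι) = ⟨k, z⟩ ↔ x = z :=
  ⟨fun h => eq_of_heq (Sigma.mk.inj h).2, fun h => h ▸ rfl⟩

open Classical in
theorem symFull_apply (η : ℤˣ) (p q : Conf ι) : symFull η p q = (p.1.factorial : ℂ)⁻¹ *
    ∑ σ : Equiv.Perm (Fin p.1), statSign η σ * if q = ⟨p.1, p.2 ∘ σ⟩ then 1 else 0 := by
  simp only [symFull, lp.coeFn_smul, lp.coeFn_sum, Pi.smul_apply, Finset.sum_apply,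
    smul_eq_mul, lp.single_apply]
  congr 1
  refine Finset.sum_congr rfl fun σ _ => ?_
  congr 1
  simp only [Pi.single_apply]

theorem symFull_mem (η : ℤˣ) (p : Conf ι) : symFull η p ∈ Fock η ι := by
  classical
  intro m z τ
  simp only [symFull_apply]
  rw [mul_left_comm]
  congr 1
  rw [Finset.mul_sum]
  obtain ⟨k, x⟩ := p
  by_cases h : m = k
  · subst h
    refine Fintype.sum_equiv (Equiv.mulRight (τ⁻¹ : Equiv.Perm (Fin m))) _ _ fun σ => ?_
    have h1 : (z ∘ τ = x ∘ σ) ↔ z = x ∘ ⇑(σ * τ⁻¹) := by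
      constructor
      · intro h
        funext a
        have := congrFun h (τ⁻¹ a)
        simpa using this
      · rintro rfl
        funext a
        simp
    simp only [Equiv.coe_mulRight, statSign_mul, statSign_inv, mk_eq_mk_iff, h1]
    rw [mul_comm (statSign η σ) (statSign η τ), ← mul_assoc, ← mul_assoc, statSign_mul_self,
      one_mul]
  · have : ∀ (w : Fin m → ι) (w' : Fin k → ι), (⟨m, w⟩ : Conf ι) ≠ ⟨k, w'⟩ := fun w w' h' =>
      h (congrArg Sigma.fst h')
    simp [this]

/-- The (anti)symmetrized product basis vector with label `p`, as a vector with a bounded number of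
particles. These vectors are neither normalized nor linearly independent: permuting the label only
changes the vector by a sign. -/
def sym (η : ℤˣ) (p : Conf ι) : FinFock η ι :=
  ⟨⟨symFull η p, symFull_mem η p⟩, p.1, fun k x h => by
    rw [symFull_apply]
    have : ∀ σ : Equiv.Perm (Fin p.1), (⟨k, x⟩ : Conf ι) ≠ ⟨p.1, p.2 ∘ σ⟩ := fun σ h' =>
      h.ne' (congrArg Sigma.fst h')
    simp [this]⟩

theorem exists_perm_of_coord_sym_ne_zero {η : ℤˣ} {p q : Conf ι} (h : coord (sym η p) q ≠ 0) :
    ∃ σ : Equiv.Perm (Fin p.1), q = ⟨p.1, p.2 ∘ σ⟩ := by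
  by_contra! hc
  refine h ?_
  change symFull η p q = 0
  simp [symFull_apply, hc]

/-- `⟪sym p, f⟫` is the coordinate of `f` with label `p`. -/
theorem inner_sym (η : ℤˣ) (p : Conf ι) (f : Fock η ι) :
    ⟪(sym η p : Fock η ι), f⟫_ℂ = (f : FullFock ι) p := by
  classical
  rw [Submodule.coe_inner]
  change ⟪symFull η p, (f : FullFock ι)⟫_ℂ = _
  rw [symFull, inner_smul_left, sum_inner]
  have h : ∀ σ : Equiv.Perm (Fin p.1), ⟪statSign η σ •
      lp.single (E := fun _ : Conf ι => ℂ) 2 (⟨p.1, p.2 ∘ σ⟩ : Conf ι) (1 : ℂ), (f : FullFock ι)⟫_ℂ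
      = (f : FullFock ι) p := by
    intro σ
    rw [inner_smul_left, lp.inner_single_left, star_statSign, RCLike.inner_apply, map_one, mul_one]
    rw [f.2 p.1 p.2 σ, ← mul_assoc, statSign_mul_self, one_mul]
  rw [Finset.sum_congr rfl fun σ _ => h σ]
  have hk : (p.1.factorial : ℂ) ≠ 0 := Nat.cast_ne_zero.2 (Nat.factorial_ne_zero _)
  simp [Fintype.card_perm, hk]

/-- Every vector is the sum of its coordinates times the vectors `sym p`. -/
theorem hasSum_sym {η : ℤˣ} (f : Fock η ι) :
    HasSum (fun p : Conf ι => (f : FullFock ι) p • (sym η p : Fock η ι)) f := by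
  classical
  have h1 : HasSum (fun p : Conf ι => lp.single 2 p ((f : FullFock ι) p)) (f : FullFock ι) :=
    lp.hasSum_single ENNReal.ofNat_ne_top _
  have h2 := h1.mapL (Fock η ι).orthogonalProjectionOnto
  rw [Submodule.orthogonalProjectionOnto_mem_subspace_eq_self] at h2
  refine h2.congr_fun fun p => ?_
  have h3 : (lp.single 2 p ((f : FullFock ι) p) : FullFock ι) =
      (f : FullFock ι) p • lp.single (E := fun _ : Conf ι => ℂ) 2 p 1 := by
    rw [← lp.single_smul]; simp
  rw [h3, map_smul]
  congr 1
  apply Subtype.ext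
  rw [← Submodule.starProjection_apply]
  refine (Submodule.eq_starProjection_of_mem_of_inner_eq_zero (sym η p : Fock η ι).2 ?_).symm
  intro w hw
  rw [inner_sub_left, lp.inner_single_left]
  have := inner_sym η p ⟨w, hw⟩
  rw [Submodule.coe_inner] at this
  rw [this]
  simp

theorem dense_finFock (η : ℤˣ) (ι : Type*) : Dense (FinFock η ι : Set (Fock η ι)) := by
  intro f
  refine mem_closure_of_tendsto (hasSum_sym f) (Filter.Eventually.of_forall fun s => ?_)
  exact Submodule.sum_mem _ fun p _ => Submodule.smul_mem _ _ (sym η p).2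

/-- Parseval's identity for the vectors `sym p`. -/
theorem hasSum_inner_sym {η : ℤˣ} (f g : Fock η ι) :
    HasSum (fun p : Conf ι => ⟪f, (sym η p : Fock η ι)⟫_ℂ * ⟪(sym η p : Fock η ι), g⟫_ℂ)
      ⟪f, g⟫_ℂ := by
  refine (lp.hasSum_inner (𝕜 := ℂ) (f : FullFock ι) (g : FullFock ι)).congr_fun fun p => ?_
  rw [← inner_conj_symm f, inner_sym, inner_sym, RCLike.inner_apply, mul_comm]

theorem hasSum_norm_sq {η : ℤˣ} (f : Fock η ι) :
    HasSum (fun p : Conf ι => ‖(f : FullFock ι) p‖ ^ 2) (‖f‖ ^ 2) := by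
  have h := lp.hasSum_norm (p := 2) (by norm_num) (f : FullFock ι)
  simpa using h

theorem coord_sym_self (η : ℤˣ) (p : Conf ι) :
    coord (sym η p) p = ((‖(sym η p : Fock η ι)‖ ^ 2 : ℝ) : ℂ) := by
  have h : ⟪(sym η p : Fock η ι), (sym η p : Fock η ι)⟫_ℂ = _ := inner_self_eq_norm_sq_to_K _
  rw [inner_sym] at h
  rw [Complex.ofReal_pow]
  exact h

theorem norm_sym_of_forall {η : ℤˣ} {p : Conf ι}
    (h : ∀ σ : Equiv.Perm (Fin p.1), statSign η σ = 1 ∧ p.2 ∘ σ = p.2) :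
    ‖(sym η p : Fock η ι)‖ = 1 := by
  have h2 : coord (sym η p) p = 1 := by
    change symFull η p p = 1
    rw [symFull_apply]
    have hk : (p.1.factorial : ℂ) ≠ 0 := Nat.cast_ne_zero.2 (Nat.factorial_ne_zero _)
    simp [h, Fintype.card_perm, hk]
  rw [coord_sym_self] at h2
  have h3 : ‖(sym η p : Fock η ι)‖ ^ 2 = 1 := by exact_mod_cast h2
  nlinarith [norm_nonneg (sym η p : Fock η ι)]

theorem norm_sym_const (i : ι) (k : ℕ) :
    ‖(sym (1 : ℤˣ) (⟨k, fun _ => i⟩ : Conf ι) : Fock 1 ι)‖ = 1 :=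
  norm_sym_of_forall fun σ => ⟨by simp [statSign], rfl⟩

theorem norm_sym_of_le_one (η : ℤˣ) (p : Conf ι) (hp : p.1 ≤ 1) :
    ‖(sym η p : Fock η ι)‖ = 1 := by
  obtain ⟨k, x⟩ := p
  refine norm_sym_of_forall fun σ => ?_
  have : σ = 1 := by
    ext a
    have h1 := (σ a).2
    have h2 := a.2
    simp only at h1 h2 hp
    simp only [Equiv.Perm.coe_one, id]
    omega
  subst this
  exact ⟨statSign_one η k, rfl⟩

end Basis

/-! ### Coordinates of the ladder operators -/

section Ladder

variable {ι H : Type*} [NormedAddCommGroup H] [InnerProductSpace ℂ H] {η : ℤˣ}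

theorem coord_annihilation (e : HilbertBasis ι ℂ H) (v : H) (f : FinFock η ι) (k : ℕ)
    (x : Fin k → ι) : coord (annihilation η e v f) ⟨k, x⟩ =
      (Real.sqrt (k + 1) : ℂ) * ∑' y : ι, ⟪v, e y⟫_ℂ * coord f ⟨k + 1, Fin.cons y x⟩ :=
  rfl

theorem coord_annihilation_basis (e : HilbertBasis ι ℂ H) (i : ι) (f : FinFock η ι) (k : ℕ)
    (x : Fin k → ι) : coord (annihilation η e (e i) f) ⟨k, x⟩ =
      (Real.sqrt (k + 1) : ℂ) * coord f ⟨k + 1, Fin.cons i x⟩ := by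
  classical
  rw [coord_annihilation, tsum_eq_single i]
  · have := (orthonormal_iff_ite.1 e.orthonormal) i i
    rw [this]
    simp
  · intro y hy
    rw [(orthonormal_iff_ite.1 e.orthonormal) i y, if_neg hy.symm, zero_mul]

theorem coord_creation_zero (e : HilbertBasis ι ℂ H) (v : H) (f : FinFock η ι) (x : Fin 0 → ι) :
    coord (creation η e v f) ⟨0, x⟩ = 0 := by
  change symmetrize η (tensorFun e v (coord f)) ⟨0, x⟩ = 0
  simp [symmetrize, tensorFun]

/-- The coordinates of `a†(v) f`, with the antisymmetrizer reduced to a sum over the slot occupied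
by `v`. -/
theorem coord_creation_succ (e : HilbertBasis ι ℂ H) (v : H) (f : FinFock η ι) (k : ℕ)
    (x : Fin (k + 1) → ι) : coord (creation η e v f) ⟨k + 1, x⟩ =
      (Real.sqrt (k + 1) : ℂ)⁻¹ * ∑ j : Fin (k + 1), eta η ^ (j : ℕ) *
        (⟪e (x j), v⟫_ℂ * coord f ⟨k, x ∘ j.succAbove⟩) := by
  change symmetrize η (tensorFun e v (coord f)) ⟨k + 1, x⟩ = _
  have h1 : ∀ (j : Fin (k + 1)) (τ : Equiv.Perm (Fin k)), statSign η (insertPerm j τ) *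
      tensorFun e v (coord f) ⟨k + 1, x ∘ insertPerm j τ⟩ = (Real.sqrt (k + 1) : ℂ) *
        (eta η ^ (j : ℕ) * (⟪e (x j), v⟫_ℂ * coord f ⟨k, x ∘ j.succAbove⟩)) := by
    intro j τ
    have h2 : Fin.tail (x ∘ insertPerm j τ) = (x ∘ j.succAbove) ∘ τ := by
      funext m
      simp [Fin.tail]
    simp only [tensorFun, h2, Function.comp_apply, insertPerm_zero, coord_perm,
      statSign_insertPerm]
    linear_combination ((Real.sqrt (k + 1) : ℂ) * (eta η ^ (j : ℕ) * (⟪e (x j), v⟫_ℂ *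
      coord f ⟨k, x ∘ j.succAbove⟩))) * statSign_mul_self (η := η) τ
  have hs : (Real.sqrt (k + 1) : ℂ) ≠ 0 := by
    rw [Complex.ofReal_ne_zero]; positivity
  have hs2 : (Real.sqrt (k + 1) : ℂ) * (Real.sqrt (k + 1) : ℂ) = (k + 1 : ℂ) := by
    rw [← Complex.ofReal_mul, Real.mul_self_sqrt (by positivity)]; push_cast; rfl
  have hk : (k.factorial : ℂ) ≠ 0 := Nat.cast_ne_zero.2 (Nat.factorial_ne_zero _)
  have hk1 : (k + 1 : ℂ) ≠ 0 := by exact_mod_cast Nat.succ_ne_zero k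
  simp only [symmetrize]
  rw [sum_perm_succ]
  simp only [h1, Finset.sum_const, Finset.card_univ, Fintype.card_perm, Fintype.card_fin,
    nsmul_eq_mul, ← Finset.mul_sum]
  rw [Nat.factorial_succ]
  push_cast
  field_simp
  rw [← hs2]
  ring

theorem coord_cons_succAbove (f : FinFock η ι) (k : ℕ) (x : Fin (k + 1) → ι) (j : Fin (k + 1)) :
    coord f ⟨k + 1, Fin.cons (x j) (x ∘ j.succAbove)⟩ = eta η ^ (j : ℕ) * coord f ⟨k + 1, x⟩ := by
  have h : (Fin.cons (x j) (x ∘ j.succAbove) : Fin (k + 1) → ι) = x ∘ insertPerm j 1 := by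
    funext m
    refine Fin.cases ?_ (fun m => ?_) m <;> simp
  rw [h, coord_perm, statSign_insertPerm, statSign_one, mul_one]

/-- The canonical (anti)commutation relation. -/
theorem annihilation_mul_creation (e : HilbertBasis ι ℂ H) (w u : H) :
    annihilation η e w * creation η e u =
      eta η • (creation η e u * annihilation η e w) + ⟪w, u⟫_ℂ • 1 := by
  refine LinearMap.ext fun f => ext_coord fun k x => ?_
  change coord (annihilation η e w (creation η e u f)) _ = eta η *
    coord (creation η e u (annihilation η e w f)) _ + ⟪w, u⟫_ℂ * coord f ⟨k, x⟩
  rw [coord_annihilation]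
  have hs : (Real.sqrt (k + 1) : ℂ) ≠ 0 := by
    rw [Complex.ofReal_ne_zero]; positivity
  have h0 := (e.hasSum_inner_mul_inner w u).mul_right (coord f ⟨k, x⟩)
  cases k with
  | zero =>
    rw [coord_creation_zero, mul_zero, ← h0.tsum_eq, ← tsum_mul_left]
    refine Eq.trans ?_ (zero_add _).symm
    refine tsum_congr fun y => ?_
    rw [coord_creation_succ, Fin.sum_univ_succ]
    simp [mul_assoc, Subsingleton.elim (α := Fin 0 → ι) _ x]
  | succ k =>
    have h1 : ∀ y, ⟪w, e y⟫_ℂ * coord (creation η e u f) ⟨k + 1 + 1, Fin.cons y x⟩ =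
        (Real.sqrt ((k + 1 : ℕ) + 1) : ℂ)⁻¹ * (⟪w, e y⟫_ℂ * ⟪e y, u⟫_ℂ * coord f ⟨k + 1, x⟩ +
          ∑ j : Fin (k + 1), eta η ^ ((j : ℕ) + 1) * (⟪e (x j), u⟫_ℂ *
            (⟪w, e y⟫_ℂ * coord f ⟨k + 1, Fin.cons y (x ∘ j.succAbove)⟩))) := by
      intro y
      rw [coord_creation_succ, Fin.sum_univ_succ, mul_left_comm, mul_add, Finset.mul_sum]
      congr 2
      · simp [Function.comp_def, mul_assoc]
      · refine Finset.sum_congr rfl fun j _ => ?_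
        have h2 : (Fin.cons y x : Fin (k + 1 + 1) → ι) ∘ j.succ.succAbove =
            Fin.cons y (x ∘ j.succAbove) := by
          funext m
          refine Fin.cases ?_ (fun m => ?_) m
          · simp
          · simp
        rw [h2, Fin.cons_succ, Fin.val_succ]
        ring
    have h3 : ∀ j : Fin (k + 1), Summable fun y =>
        ⟪w, e y⟫_ℂ * coord f ⟨k + 1, Fin.cons y (x ∘ j.succAbove)⟩ := fun j =>
      (hasSum_contract e w f k (x ∘ j.succAbove)).summable
    have h4 : ∀ j : Fin (k + 1), coord (annihilation η e w f) ⟨k, x ∘ j.succAbove⟩ =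
        (Real.sqrt (k + 1) : ℂ) * ∑' y : ι,
          ⟪w, e y⟫_ℂ * coord f ⟨k + 1, Fin.cons y (x ∘ j.succAbove)⟩ := fun j => rfl
    have hs' : (Real.sqrt (k + 1) : ℂ) ≠ 0 := by
      rw [Complex.ofReal_ne_zero]; positivity
    simp only [h1]
    rw [tsum_mul_left, h0.summable.tsum_add (summable_sum fun j _ =>
      ((h3 j).mul_left _).mul_left _), h0.tsum_eq, Summable.tsum_finsetSum (fun j _ =>
      ((h3 j).mul_left _).mul_left _), ← mul_assoc, mul_inv_cancel₀ hs, one_mul, add_comm,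
      coord_creation_succ]
    congr 1
    simp only [h4, tsum_mul_left]
    rw [Finset.mul_sum, Finset.mul_sum]
    refine Finset.sum_congr rfl fun j _ => ?_
    rw [pow_succ]
    field_simp

theorem annihilation_mul_annihilation_basis (e : HilbertBasis ι ℂ H) (w : H) (i : ι) :
    annihilation η e w * annihilation η e (e i) =
      eta η • (annihilation η e (e i) * annihilation η e w) := by
  refine LinearMap.ext fun f => ext_coord fun k x => ?_
  change coord (annihilation η e w (annihilation η e (e i) f)) _ = eta η *
    coord (annihilation η e (e i) (annihilation η e w f)) _
  rw [coord_annihilation, coord_annihilation_basis, coord_annihilation]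
  have h : ∀ y, ⟪w, e y⟫_ℂ * coord (annihilation η e (e i) f) ⟨k + 1, Fin.cons y x⟩ =
      (eta η * (Real.sqrt ((k + 1 : ℕ) + 1) : ℂ)) *
        (⟪w, e y⟫_ℂ * coord f ⟨k + 1 + 1, Fin.cons y (Fin.cons i x)⟩) := by
    intro y
    rw [coord_annihilation_basis]
    have h1 : (Fin.cons i (Fin.cons y x) : Fin (k + 1 + 1) → ι) =
        (Fin.cons y (Fin.cons i x) : Fin (k + 1 + 1) → ι) ∘ insertPerm 1 1 := by
      funext m
      refine Fin.cases ?_ (fun m => ?_) m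
      · rw [Function.comp_apply, insertPerm_zero]
        rfl
      · rw [Function.comp_apply, insertPerm_succ]
        refine Fin.cases ?_ (fun m => ?_) m
        · simp
        · simp
    rw [h1, coord_perm, statSign_insertPerm, statSign_one, Fin.val_one, pow_one]
    ring
  simp only [h, tsum_mul_left]
  ring

end Ladder

/-! ### Adjoints and bounds -/

theorem inner_smul_right_fock {η : ℤˣ} {ι : Type*} (f g : Fock η ι) (c : ℂ) :
    ⟪f, c • g⟫_ℂ = c * ⟪f, g⟫_ℂ :=
  inner_smul_right f g c

theorem inner_smul_left_fock {η : ℤˣ} {ι : Type*} (f g : Fock η ι) (c : ℂ) :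
    ⟪c • f, g⟫_ℂ = (starRingEnd ℂ) c * ⟪f, g⟫_ℂ :=
  inner_smul_left f g c

section Adjoint

variable {ι H : Type*} [NormedAddCommGroup H] [InnerProductSpace ℂ H] {η : ℤˣ}

theorem coord_insertNth (g : FinFock η ι) (k : ℕ) (j : Fin (k + 1)) (y : ι) (x : Fin k → ι) :
    coord g ⟨k + 1, j.insertNth y x⟩ = eta η ^ (j : ℕ) * coord g ⟨k + 1, Fin.cons y x⟩ := by
  have h := coord_cons_succAbove g k (j.insertNth y x : Fin (k + 1) → ι) j
  have h2 : (j.insertNth y x : Fin (k + 1) → ι) ∘ j.succAbove = x := by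
    funext m; simp
  rw [h2, Fin.insertNth_apply_same] at h
  rw [h, ← mul_assoc, ← mul_pow, eta_mul_self, one_pow, one_mul]

theorem summable_adjoint_aux (e : HilbertBasis ι ℂ H) (v : H) (f g : FinFock η ι) (k : ℕ) :
    Summable fun q : (Fin k → ι) × ι => (starRingEnd ℂ) (coord f ⟨k, q.1⟩) *
      (⟪v, e q.2⟫_ℂ * coord g ⟨k + 1, Fin.cons q.2 q.1⟩) := by
  have h1 : Summable fun q : (Fin k → ι) × ι =>
      ‖(starRingEnd ℂ) (coord f ⟨k, q.1⟩) * ⟪v, e q.2⟫_ℂ‖ ^ 2 := by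
    have := (summable_sector f k).mul_of_nonneg (summable_inner_sq e v)
      (fun _ => by positivity) (fun _ => by positivity)
    refine this.congr fun q => ?_
    rw [norm_mul, mul_pow, RCLike.norm_conj, norm_inner_symm]
  have h2 : Summable fun q : (Fin k → ι) × ι => ‖coord g ⟨k + 1, Fin.cons q.2 q.1⟩‖ ^ 2 := by
    have h := (summable_sector g (k + 1)).comp_injective
      (i := fun q : (Fin k → ι) × ι => (Fin.cons q.2 q.1 : Fin (k + 1) → ι)) (by
        rintro ⟨x, y⟩ ⟨x', y'⟩ h
        obtain ⟨h1, h2⟩ := Fin.cons_injective2 (α := fun _ => ι) h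
        simp only at h1 h2
        rw [h1, h2])
    simpa [Function.comp_def] using h
  exact (summable_mul_of_sq h1 h2).congr fun q => by ring

/-- Adjointness of the ladder operators, between the `k`- and the `(k + 1)`-particle sectors. -/
theorem tsum_sector_adjoint (e : HilbertBasis ι ℂ H) (v : H) (f g : FinFock η ι) (k : ℕ) :
    ∑' x : Fin (k + 1) → ι, (starRingEnd ℂ) (coord (creation η e v f) ⟨k + 1, x⟩) *
      coord g ⟨k + 1, x⟩ = ∑' x : Fin k → ι, (starRingEnd ℂ) (coord f ⟨k, x⟩) *
        coord (annihilation η e v g) ⟨k, x⟩ := by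
  have hs := summable_adjoint_aux e v f g k
  set A : ℂ := ∑' q : (Fin k → ι) × ι, (starRingEnd ℂ) (coord f ⟨k, q.1⟩) *
      (⟪v, e q.2⟫_ℂ * coord g ⟨k + 1, Fin.cons q.2 q.1⟩) with hA
  have hR : ∑' x : Fin k → ι, (starRingEnd ℂ) (coord f ⟨k, x⟩) *
        coord (annihilation η e v g) ⟨k, x⟩ = (Real.sqrt (k + 1) : ℂ) * A := by
    rw [hA, hs.tsum_prod, ← tsum_mul_left]
    refine tsum_congr fun x => ?_
    rw [coord_annihilation]
    simp only [tsum_mul_left]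
    ring
  have hj : ∀ j : Fin (k + 1), HasSum (fun x : Fin (k + 1) → ι => (starRingEnd ℂ)
      (eta η ^ (j : ℕ) * (⟪e (x j), v⟫_ℂ * coord f ⟨k, x ∘ j.succAbove⟩)) *
      coord g ⟨k + 1, x⟩) A := by
    intro j
    rw [← (((Equiv.prodComm _ _).trans (Fin.insertNthEquiv (fun _ => ι) j))).hasSum_iff]
    refine hs.hasSum.congr_fun fun q => ?_
    have h2 : (j.insertNth q.2 q.1 : Fin (k + 1) → ι) ∘ j.succAbove = q.1 := by
      funext m; simp
    have h3 : eta η ^ (j : ℕ) * eta η ^ (j : ℕ) = 1 := by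
      rw [← mul_pow, eta_mul_self, one_pow]
    have h4 : ((Equiv.prodComm _ _).trans (Fin.insertNthEquiv (fun _ => ι) j)) q =
        (j.insertNth q.2 q.1 : Fin (k + 1) → ι) := rfl
    simp only [Function.comp_apply, h4, h2, Fin.insertNth_apply_same, coord_insertNth, map_mul,
      map_pow, star_eta, inner_conj_symm]
    linear_combination ((starRingEnd ℂ) (coord f ⟨k, q.1⟩) *
      (⟪v, e q.2⟫_ℂ * coord g ⟨k + 1, Fin.cons q.2 q.1⟩)) * h3
  have hL := (hasSum_sum (s := Finset.univ) fun j _ => hj j).mul_left (Real.sqrt (k + 1) : ℂ)⁻¹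
  have hs' : (Real.sqrt (k + 1) : ℂ) ≠ 0 := by
    rw [Complex.ofReal_ne_zero]; positivity
  have hs2 : (Real.sqrt (k + 1) : ℂ) * (Real.sqrt (k + 1) : ℂ) = (k + 1 : ℂ) := by
    rw [← Complex.ofReal_mul, Real.mul_self_sqrt (by positivity)]; push_cast; rfl
  rw [hR]
  refine Eq.trans ?_ (hL.tsum_eq.trans ?_)
  · refine tsum_congr fun x => ?_
    rw [coord_creation_succ, map_mul, map_sum, ← Finset.sum_mul, mul_assoc, map_inv₀,
      Complex.conj_ofReal]
  · simp only [Finset.sum_const, Finset.card_univ, Fintype.card_fin, nsmul_eq_mul]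
    push_cast
    field_simp
    rw [← hs2]
    ring

theorem inner_eq_tsum (f g : FinFock η ι) :
    ⟪(f : Fock η ι), (g : Fock η ι)⟫_ℂ =
      ∑' k : ℕ, ∑' x : Fin k → ι, (starRingEnd ℂ) (coord f ⟨k, x⟩) * coord g ⟨k, x⟩ := by
  have h : HasSum (fun p : Conf ι => (starRingEnd ℂ) (coord f p) * coord g p)
      ⟪(f : Fock η ι), (g : Fock η ι)⟫_ℂ := by
    refine (lp.hasSum_inner (𝕜 := ℂ) (f : Fock η ι).1 (g : Fock η ι).1).congr_fun fun p => ?_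
    rw [RCLike.inner_apply, mul_comm]
    rfl
  rw [← h.tsum_eq]
  exact h.summable.tsum_sigma

theorem inner_creation (e : HilbertBasis ι ℂ H) (v : H) (f g : FinFock η ι) :
    ⟪(creation η e v f : Fock η ι), (g : Fock η ι)⟫_ℂ =
      ⟪(f : Fock η ι), (annihilation η e v g : Fock η ι)⟫_ℂ := by
  rw [inner_eq_tsum, inner_eq_tsum]
  obtain ⟨K, hK⟩ := g.2
  have hK' : ∀ (k : ℕ) (x : Fin k → ι), K < k → coord g ⟨k, x⟩ = 0 := hK
  rw [tsum_eq_sum (s := Finset.range (K + 2)), tsum_eq_sum (s := Finset.range (K + 1)),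
    Finset.sum_range_succ']
  · simp [coord_creation_zero, tsum_sector_adjoint]
  · intro k hk
    have hk' : K < k := by simpa using hk
    have : ∀ (x : Fin k → ι) (y : ι), coord g ⟨k + 1, Fin.cons y x⟩ = 0 := fun x y =>
      hK' _ _ (by omega)
    simp [coord_annihilation, this]
  · intro k hk
    have hk' : K + 2 ≤ k := by simpa using hk
    simp [hK' _ _ (show K < k by omega)]

theorem inner_annihilation (e : HilbertBasis ι ℂ H) (v : H) (f g : FinFock η ι) :
    ⟪(annihilation η e v f : Fock η ι), (g : Fock η ι)⟫_ℂ =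
      ⟪(f : Fock η ι), (creation η e v g : Fock η ι)⟫_ℂ := by
  rw [← inner_conj_symm, ← inner_creation, inner_conj_symm]

theorem ext_inner_finFock {f f' : FinFock η ι}
    (h : ∀ g : FinFock η ι,
      ⟪(f : Fock η ι), (g : Fock η ι)⟫_ℂ = ⟪(f' : Fock η ι), (g : Fock η ι)⟫_ℂ) :
    f = f' := by
  refine ext_coord fun k x => ?_
  have h1 := congrArg (starRingEnd ℂ) (h (sym η ⟨k, x⟩))
  rw [inner_conj_symm, inner_conj_symm, inner_sym, inner_sym] at h1
  exact h1

theorem creation_mul_creation_basis (e : HilbertBasis ι ℂ H) (w : H) (i : ι) :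
    creation η e w * creation η e (e i) = eta η • (creation η e (e i) * creation η e w) := by
  refine LinearMap.ext fun f => ext_inner_finFock fun g => ?_
  change ⟪(creation η e w (creation η e (e i) f) : Fock η ι), (g : Fock η ι)⟫_ℂ =
    ⟪eta η • (creation η e (e i) (creation η e w f) : Fock η ι), (g : Fock η ι)⟫_ℂ
  have h := congrArg (fun O : Module.End ℂ (FinFock η ι) => ⟪(f : Fock η ι), (O g : Fock η ι)⟫_ℂ)
    (annihilation_mul_annihilation_basis (η := η) e w i)
  have h2 : ⟪(f : Fock η ι), (annihilation η e w (annihilation η e (e i) g) : Fock η ι)⟫_ℂ =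
    ⟪(f : Fock η ι), eta η • (annihilation η e (e i) (annihilation η e w g) : Fock η ι)⟫_ℂ := h
  rw [inner_smul_right_fock] at h2
  rw [inner_smul_left_fock, star_eta, inner_creation, inner_creation, inner_creation,
    inner_creation, h2, ← mul_assoc, eta_mul_self, one_mul]

/-- `f` has no components with more than `K` particles. -/
def ParticlesLE (K : ℕ) (f : FinFock η ι) : Prop :=
  ∀ (k : ℕ) (x : Fin k → ι), K < k → coord f ⟨k, x⟩ = 0

theorem ParticlesLE.mono {K L : ℕ} (h : K ≤ L) {f : FinFock η ι} (hf : ParticlesLE K f) :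
    ParticlesLE L f := fun k x hk => hf k x (h.trans_lt hk)

theorem particlesLE_sym (p : Conf ι) : ParticlesLE p.1 (sym η p) := by
  intro k x hk
  by_contra h
  obtain ⟨σ, hσ⟩ := exists_perm_of_coord_sym_ne_zero h
  have := congrArg Sigma.fst hσ
  simp only at this
  omega

theorem ParticlesLE.coord_annihilation_eq_zero (e : HilbertBasis ι ℂ H) (v : H) {K : ℕ}
    {f : FinFock η ι} (hf : ParticlesLE K f) {k : ℕ} (x : Fin k → ι) (hk : K ≤ k) :
    coord (WickFock.annihilation η e v f) ⟨k, x⟩ = 0 := by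
  have : ∀ y : ι, coord f ⟨k + 1, Fin.cons y x⟩ = 0 := fun y => hf _ _ (by omega)
  simp [coord_annihilation, this]

theorem ParticlesLE.annihilation (e : HilbertBasis ι ℂ H) (v : H) {K : ℕ} {f : FinFock η ι}
    (hf : ParticlesLE K f) : ParticlesLE K (WickFock.annihilation η e v f) :=
  fun _ x hk => hf.coord_annihilation_eq_zero e v x hk.le

theorem ParticlesLE.creation (e : HilbertBasis ι ℂ H) (v : H) {K : ℕ} {f : FinFock η ι}
    (hf : ParticlesLE K f) : ParticlesLE (K + 1) (WickFock.creation η e v f) := by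
  intro k x hk
  obtain ⟨k, rfl⟩ : ∃ m, k = m + 1 := ⟨k - 1, by omega⟩
  have : ∀ x : Fin k → ι, coord f ⟨k, x⟩ = 0 := fun x => hf _ _ (by omega)
  simp [coord_creation_succ, this]

theorem norm_coord_annihilation_sq_le (e : HilbertBasis ι ℂ H) (v : H) (f : FinFock η ι) (k : ℕ)
    (x : Fin k → ι) : ‖coord (annihilation η e v f) ⟨k, x⟩‖ ^ 2 ≤
      ((k + 1 : ℝ) * ‖v‖ ^ 2) * ∑' y : ι, ‖coord f ⟨k + 1, Fin.cons y x⟩‖ ^ 2 := by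
  rw [coord_annihilation]
  have h0 : ∑' y : ι, ⟪v, e y⟫_ℂ * coord f ⟨k + 1, Fin.cons y x⟩ =
      ⟪e.repr v, (⟨_, summable_slice f k x⟩ : lp (fun _ : ι => ℂ) 2)⟫_ℂ :=
    (hasSum_contract e v f k x).tsum_eq
  rw [h0, norm_mul, mul_pow, mul_assoc]
  have hk : ‖(Real.sqrt (k + 1) : ℂ)‖ ^ 2 = (k + 1 : ℝ) := by
    rw [Complex.norm_real, Real.norm_eq_abs, sq_abs, Real.sq_sqrt (by positivity)]
  rw [hk]
  refine mul_le_mul_of_nonneg_left ?_ (by positivity)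
  have h2 := norm_inner_le_norm (𝕜 := ℂ) (e.repr v)
    (⟨_, summable_slice f k x⟩ : lp (fun _ : ι => ℂ) 2)
  have h3 : ‖(⟨_, summable_slice f k x⟩ : lp (fun _ : ι => ℂ) 2)‖ ^ 2 =
      ∑' y : ι, ‖coord f ⟨k + 1, Fin.cons y x⟩‖ ^ 2 := by
    have := lp.norm_rpow_eq_tsum (p := 2) (by norm_num)
      (⟨_, summable_slice f k x⟩ : lp (fun _ : ι => ℂ) 2)
    simpa using this
  rw [LinearIsometryEquiv.norm_map] at h2
  calc _ ≤ (‖v‖ * ‖(⟨_, summable_slice f k x⟩ : lp (fun _ : ι => ℂ) 2)‖) ^ 2 :=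
        pow_le_pow_left₀ (norm_nonneg _) h2 2
    _ = _ := by rw [mul_pow, h3]

theorem norm_annihilation_le (e : HilbertBasis ι ℂ H) (v : H) {K : ℕ} {f : FinFock η ι}
    (hf : ParticlesLE K f) :
    ‖(annihilation η e v f : Fock η ι)‖ ≤ Real.sqrt K * ‖v‖ * ‖(f : Fock η ι)‖ := by
  have h1 := hasSum_norm_sq (annihilation η e v f : Fock η ι)
  have h2 := hasSum_norm_sq (f : Fock η ι)
  have hinj : Function.Injective fun q : (p : Conf ι) × ι =>
      (⟨q.1.1 + 1, Fin.cons q.2 q.1.2⟩ : Conf ι) := by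
    rintro ⟨⟨k, x⟩, y⟩ ⟨⟨k', x'⟩, y'⟩ h
    obtain rfl : k = k' := by
      have := congrArg Sigma.fst h
      simpa using this
    obtain ⟨h1, h2⟩ := Fin.cons_injective2 (α := fun _ => ι) (mk_eq_mk_iff.1 h)
    simp only at h1 h2
    rw [h1, h2]
  have h3 : Summable fun q : (p : Conf ι) × ι => ‖coord f ⟨q.1.1 + 1, Fin.cons q.2 q.1.2⟩‖ ^ 2 :=
    h2.summable.comp_injective hinj
  have h4 : ∑' p : Conf ι, ∑' y : ι, ‖coord f ⟨p.1 + 1, Fin.cons y p.2⟩‖ ^ 2 ≤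
      ‖(f : Fock η ι)‖ ^ 2 := by
    rw [← h2.tsum_eq, ← h3.tsum_sigma]
    exact h3.tsum_le_tsum_of_inj _ hinj (fun _ _ => by positivity) (fun _ => le_rfl) h2.summable
  have h5 : ‖(annihilation η e v f : Fock η ι)‖ ^ 2 ≤ (K * ‖v‖ ^ 2) * ‖(f : Fock η ι)‖ ^ 2 := by
    rw [← h1.tsum_eq]
    refine le_trans (h1.summable.tsum_le_tsum (fun p => ?_) (h3.sigma.mul_left (K * ‖v‖ ^ 2))) ?_
    · obtain ⟨k, x⟩ := p
      by_cases hk : k + 1 ≤ K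
      · refine (norm_coord_annihilation_sq_le e v f k x).trans ?_
        have : (k + 1 : ℝ) ≤ K := by exact_mod_cast hk
        refine mul_le_mul_of_nonneg_right ?_ (tsum_nonneg fun _ => by positivity)
        gcongr
      · have h6 : ((annihilation η e v f : Fock η ι) : FullFock ι) ⟨k, x⟩ = 0 :=
          hf.coord_annihilation_eq_zero e v x (by omega)
        rw [h6, norm_zero, zero_pow two_ne_zero]
        exact mul_nonneg (by positivity) (tsum_nonneg fun _ => by positivity)
    · rw [tsum_mul_left]
      exact mul_le_mul_of_nonneg_left h4 (by positivity)
  refine le_of_sq_le_sq ?_ (by positivity)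
  rw [mul_pow, mul_pow, Real.sq_sqrt (by positivity)]
  exact h5

theorem norm_creation_le (e : HilbertBasis ι ℂ H) (v : H) {K : ℕ} {f : FinFock η ι}
    (hf : ParticlesLE K f) :
    ‖(creation η e v f : Fock η ι)‖ ≤ Real.sqrt (K + 1) * ‖v‖ * ‖(f : Fock η ι)‖ := by
  have h1 : ‖(creation η e v f : Fock η ι)‖ ^ 2 =
      ‖⟪(f : Fock η ι), (annihilation η e v (creation η e v f) : Fock η ι)⟫_ℂ‖ := by
    rw [← inner_creation, inner_self_eq_norm_sq_to_K]
    simp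
  have h2 := norm_annihilation_le e v (hf.creation e v)
  have h3 := norm_inner_le_norm (𝕜 := ℂ) (f : Fock η ι)
    (annihilation η e v (creation η e v f) : Fock η ι)
  rw [← h1] at h3
  push_cast at h2
  rcases (norm_nonneg (creation η e v f : Fock η ι)).eq_or_lt with h | h
  · rw [← h]; positivity
  · refine le_of_mul_le_mul_right ?_ h
    rw [← sq]
    calc _ ≤ _ := h3
      _ ≤ ‖(f : Fock η ι)‖ * (Real.sqrt (K + 1) * ‖v‖ * ‖(creation η e v f : Fock η ι)‖) := by
        gcongr
      _ = _ := by ring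

end Adjoint

/-! ### Nuclear operators -/

theorem summable_mul_of_hasSum_sq {α : Type*} {f g : α → ℝ} (hf0 : ∀ a, 0 ≤ f a)
    (hg0 : ∀ a, 0 ≤ g a) {A B : ℝ} (hA : 0 ≤ A) (hB : 0 ≤ B)
    (hf : HasSum (fun a => f a ^ 2) (A ^ 2)) (hg : HasSum (fun a => g a ^ 2) (B ^ 2)) :
    (Summable fun a => f a * g a) ∧ ∑' a, f a * g a ≤ A * B := by
  have h := Real.summable_and_inner_le_Lp_mul_Lq_tsum_of_nonneg (p := 2) (q := 2) (f := f) (g := g)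
    Real.HolderConjugate.two_two hf0 hg0 (by simpa using hf.summable) (by simpa using hg.summable)
  refine ⟨h.1, h.2.trans (le_of_eq ?_)⟩
  simp only [Real.rpow_two, hf.tsum_eq, hg.tsum_eq, ← Real.sqrt_eq_rpow, Real.sqrt_sq hA,
    Real.sqrt_sq hB]

section Trace

variable {E : Type*} [NormedAddCommGroup E] [InnerProductSpace ℂ E]

theorem hasSum_norm_inner_sq {κ : Type*} (f : HilbertBasis κ ℂ E) (x : E) :
    HasSum (fun i => ‖⟪f i, x⟫_ℂ‖ ^ 2) (‖x‖ ^ 2) := by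
  have h := lp.hasSum_norm (p := 2) (by norm_num) (f.repr x)
  simpa [HilbertBasis.repr_apply_apply] using h

/-- An operator `∑ a, |u a⟩⟨w a|` with `∑ a, ‖w a‖ ‖u a‖ < ∞` is trace-class, with trace
`∑ a, ⟪w a, u a⟫`. -/
theorem hasTrace_of_nuclear {α : Type*} (u w : α → E) (hs : Summable fun a => ‖w a‖ * ‖u a‖)
    (T : E →L[ℂ] E) (hT : ∀ x, HasSum (fun a => ⟪w a, x⟫_ℂ • u a) (T x)) :
    HasTrace T (∑' a, ⟪w a, u a⟫_ℂ) := by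
  intro s f
  have h1 : ∀ a, (Summable fun i => ‖⟪f i, w a⟫_ℂ‖ * ‖⟪f i, u a⟫_ℂ‖) ∧
      ∑' i, ‖⟪f i, w a⟫_ℂ‖ * ‖⟪f i, u a⟫_ℂ‖ ≤ ‖w a‖ * ‖u a‖ := fun a =>
    summable_mul_of_hasSum_sq (fun _ => norm_nonneg _) (fun _ => norm_nonneg _) (norm_nonneg _)
      (norm_nonneg _) (hasSum_norm_inner_sq f (w a)) (hasSum_norm_inner_sq f (u a))
  have h2 : Summable fun q : α × s => ⟪w q.1, f q.2⟫_ℂ * ⟪f q.2, u q.1⟫_ℂ := by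
    refine Summable.of_norm ?_
    rw [summable_prod_of_nonneg (fun _ => norm_nonneg _)]
    simp only [norm_mul]
    have h3 : ∀ a i, ‖⟪w a, f i⟫_ℂ‖ = ‖⟪f i, w a⟫_ℂ‖ := fun a i => norm_inner_symm _ _
    simp only [h3]
    exact ⟨fun a => (h1 a).1, Summable.of_nonneg_of_le
      (fun a => tsum_nonneg fun _ => by positivity) (fun a => (h1 a).2) hs⟩
  have h4 : ∑' a, ⟪w a, u a⟫_ℂ = ∑' q : α × s, ⟪w q.1, f q.2⟫_ℂ * ⟪f q.2, u q.1⟫_ℂ := by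
    rw [h2.tsum_prod]
    exact tsum_congr fun a => (f.tsum_inner_mul_inner (w a) (u a)).symm
  rw [h4]
  have h5 := (Equiv.prodComm s α).hasSum_iff.2 h2.hasSum
  refine h5.prod_fiberwise fun i => ?_
  have h6 := (hT (f i)).mapL (innerSL ℂ (f i))
  simpa [inner_smul_right] using h6

theorem HasTrace.unique [CompleteSpace E] {T : E →L[ℂ] E} {z z' : ℂ} (h : HasTrace T z)
    (h' : HasTrace T z') : z = z' := by
  obtain ⟨s, f, -⟩ := exists_hilbertBasis ℂ E
  exact (h s f).unique (h' s f)

/-- A summable family of rank-one operators defines a bounded operator. -/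
theorem exists_nuclear [CompleteSpace E] {α : Type*} (u w : α → E)
    (hs : Summable fun a => ‖w a‖ * ‖u a‖) :
    ∃ T : E →L[ℂ] E, ∀ x, HasSum (fun a => ⟪w a, x⟫_ℂ • u a) (T x) := by
  have h : Summable fun a => (innerSL ℂ (w a)).smulRight (u a) := by
    refine Summable.of_norm (hs.congr fun a => ?_)
    rw [ContinuousLinearMap.norm_smulRight_apply, innerSL_apply_norm]
  refine ⟨∑' a, (innerSL ℂ (w a)).smulRight (u a), fun x => ?_⟩
  have h2 := h.hasSum.mapL (ContinuousLinearMap.apply ℂ E x)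
  simpa using h2

end Trace

theorem HasExpectation.unique {η : ℤˣ} {ι : Type*} {ρ : Fock η ι →L[ℂ] Fock η ι}
    {O : Module.End ℂ (FinFock η ι)} {z z' : ℂ} (h : HasExpectation ρ O z)
    (h' : HasExpectation ρ O z') : z = z' := by
  obtain ⟨T, hT, hz⟩ := h
  obtain ⟨T', hT', hz'⟩ := h'
  have : T = T' := by
    refine ContinuousLinearMap.coeFn_injective
      (T.continuous.ext_on (dense_finFock η ι) T'.continuous fun f hf => ?_)
    exact (hT ⟨f, hf⟩).trans (hT' ⟨f, hf⟩).symm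
  subst this
  exact hz.unique hz'

theorem HasExpectation.expectation_eq {η : ℤˣ} {ι : Type*} {ρ : Fock η ι →L[ℂ] Fock η ι}
    {O : Module.End ℂ (FinFock η ι)} {z : ℂ} (h : HasExpectation ρ O z) :
    expectation ρ O = z := by
  have h' : ∃ z, HasExpectation ρ O z := ⟨z, h⟩
  rw [expectation, dif_pos h']
  exact h'.choose_spec.unique h

/-! ### Operators bounded polynomially in the particle number -/

section Admissible

variable {η : ℤˣ} {ι : Type*}

/-- `O` raises the number of particles by a bounded amount, and its norm on the vectors with at most
`K` particles grows at most polynomially in `K`. -/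
def PolyBounded (O : Module.End ℂ (FinFock η ι)) : Prop :=
  ∃ (d m : ℕ) (C : ℝ), 0 ≤ C ∧ ∀ (K : ℕ) (f : FinFock η ι), ParticlesLE K f →
    ParticlesLE (K + d) (O f) ∧ ‖(O f : Fock η ι)‖ ≤ C * (K + 1) ^ m * ‖(f : Fock η ι)‖

theorem PolyBounded.add {O O' : Module.End ℂ (FinFock η ι)} (h : PolyBounded O)
    (h' : PolyBounded O') : PolyBounded (O + O') := by
  obtain ⟨d, m, C, hC, h⟩ := h
  obtain ⟨d', m', C', hC', h'⟩ := h'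
  refine ⟨d + d', m + m', C + C', by positivity, fun K f hf => ⟨fun k x hk => ?_, ?_⟩⟩
  · change coord (O f) _ + coord (O' f) _ = 0
    rw [(h K f hf).1 k x (by omega), (h' K f hf).1 k x (by omega), add_zero]
  · have h1 : (1 : ℝ) ≤ (K : ℝ) + 1 := by linarith [Nat.cast_nonneg (α := ℝ) K]
    calc ‖((O f + O' f : FinFock η ι) : Fock η ι)‖
        ≤ ‖(O f : Fock η ι)‖ + ‖(O' f : Fock η ι)‖ := norm_add_le _ _
      _ ≤ C * (K + 1) ^ m * ‖(f : Fock η ι)‖ + C' * (K + 1) ^ m' * ‖(f : Fock η ι)‖ :=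
          add_le_add (h K f hf).2 (h' K f hf).2
      _ ≤ C * (K + 1) ^ (m + m') * ‖(f : Fock η ι)‖ +
            C' * (K + 1) ^ (m + m') * ‖(f : Fock η ι)‖ := by
          gcongr <;> first | exact h1 | omega
      _ = _ := by ring

theorem PolyBounded.mul {O O' : Module.End ℂ (FinFock η ι)} (h : PolyBounded O)
    (h' : PolyBounded O') : PolyBounded (O * O') := by
  obtain ⟨d, m, C, hC, h⟩ := h
  obtain ⟨d', m', C', hC', h'⟩ := h'
  refine ⟨d' + d, m + m', C * C' * (d' + 1) ^ m, by positivity, fun K f hf => ?_⟩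
  obtain ⟨h1, h2⟩ := h' K f hf
  obtain ⟨h3, h4⟩ := h _ _ h1
  refine ⟨h3.mono (by omega), ?_⟩
  calc ‖(O (O' f) : Fock η ι)‖ ≤ C * ((K + d' : ℕ) + 1) ^ m * ‖(O' f : Fock η ι)‖ := h4
    _ ≤ C * ((d' + 1) * (K + 1)) ^ m * (C' * (K + 1) ^ m' * ‖(f : Fock η ι)‖) := by
        gcongr
        push_cast
        nlinarith [mul_nonneg (Nat.cast_nonneg (α := ℝ) K) (Nat.cast_nonneg (α := ℝ) d')]
    _ = _ := by rw [mul_pow]; ring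

theorem PolyBounded.smul_one (c : ℂ) : PolyBounded (c • (1 : Module.End ℂ (FinFock η ι))) := by
  refine ⟨0, 0, ‖c‖, norm_nonneg _, fun K f hf => ⟨fun k x hk => ?_, ?_⟩⟩
  · change c * coord f _ = 0
    rw [hf k x (by omega), mul_zero]
  · change ‖c • (f : Fock η ι)‖ ≤ _
    rw [norm_smul]; simp

variable (η ι) in
/-- The algebra of the operators that are polynomially bounded in the particle number, together with
a formal adjoint. It contains all polynomials in the ladder operators. -/
def admissible : Subalgebra ℂ (Module.End ℂ (FinFock η ι)) where
  carrier := {O | PolyBounded O ∧ ∃ O' : Module.End ℂ (FinFock η ι), PolyBounded O' ∧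
    ∀ f g : FinFock η ι,
      ⟪(O' f : Fock η ι), (g : Fock η ι)⟫_ℂ = ⟪(f : Fock η ι), (O g : Fock η ι)⟫_ℂ}
  mul_mem' := by
    rintro A B ⟨hA, A', hA', hAA⟩ ⟨hB, B', hB', hBB⟩
    exact ⟨hA.mul hB, B' * A', hB'.mul hA', fun f g => (hBB _ _).trans (hAA _ _)⟩
  add_mem' := by
    rintro A B ⟨hA, A', hA', hAA⟩ ⟨hB, B', hB', hBB⟩
    refine ⟨hA.add hB, A' + B', hA'.add hB', fun f g => ?_⟩
    refine (inner_add_left (A' f : Fock η ι) (B' f : Fock η ι) (g : Fock η ι)).trans ?_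
    refine Eq.trans ?_ (inner_add_right (f : Fock η ι) (A g : Fock η ι) (B g : Fock η ι)).symm
    exact congrArg₂ (· + ·) (hAA f g) (hBB f g)
  algebraMap_mem' c := by
    rw [Algebra.algebraMap_eq_smul_one]
    refine ⟨PolyBounded.smul_one c, (starRingEnd ℂ) c • 1, PolyBounded.smul_one _, fun f g => ?_⟩
    refine (inner_smul_left_fock (f : Fock η ι) (g : Fock η ι) _).trans ?_
    rw [Complex.conj_conj]
    exact (inner_smul_right_fock (f : Fock η ι) (g : Fock η ι) _).symm

theorem mem_admissible {O : Module.End ℂ (FinFock η ι)} : O ∈ admissible η ι ↔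
    PolyBounded O ∧ ∃ O' : Module.End ℂ (FinFock η ι), PolyBounded O' ∧ ∀ f g : FinFock η ι,
      ⟪(O' f : Fock η ι), (g : Fock η ι)⟫_ℂ = ⟪(f : Fock η ι), (O g : Fock η ι)⟫_ℂ :=
  Iff.rfl

variable {H : Type*} [NormedAddCommGroup H] [InnerProductSpace ℂ H]

theorem sqrt_le_add_one (K : ℕ) : Real.sqrt (K + 1) ≤ K + 1 := by
  have h : (0 : ℝ) ≤ K := Nat.cast_nonneg K
  rw [Real.sqrt_le_left (by positivity)]
  nlinarith

theorem polyBounded_annihilation (e : HilbertBasis ι ℂ H) (v : H) :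
    PolyBounded (annihilation η e v) := by
  refine ⟨0, 1, ‖v‖, norm_nonneg _, fun K f hf => ⟨hf.annihilation e v, ?_⟩⟩
  refine (norm_annihilation_le e v hf).trans ?_
  rw [pow_one, mul_comm ‖v‖]
  gcongr
  exact (Real.sqrt_le_sqrt (by linarith)).trans (sqrt_le_add_one K)

theorem polyBounded_creation (e : HilbertBasis ι ℂ H) (v : H) :
    PolyBounded (creation η e v) := by
  refine ⟨1, 1, ‖v‖, norm_nonneg _, fun K f hf => ⟨hf.creation e v, ?_⟩⟩
  refine (norm_creation_le e v hf).trans ?_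
  rw [pow_one, mul_comm ‖v‖]
  gcongr
  exact sqrt_le_add_one K

theorem annihilation_mem_admissible (e : HilbertBasis ι ℂ H) (v : H) :
    annihilation η e v ∈ admissible η ι :=
  ⟨polyBounded_annihilation e v, creation η e v, polyBounded_creation e v, inner_creation e v⟩

theorem creation_mem_admissible (e : HilbertBasis ι ℂ H) (v : H) :
    creation η e v ∈ admissible η ι :=
  ⟨polyBounded_creation e v, annihilation η e v, polyBounded_annihilation e v,
    inner_annihilation e v⟩

end Admissible

/-! ### The Gaussian operator in coordinates -/

section Weight

variable {ι : Type*}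

/-- The eigenvalue `∏ j, y (x j)` of the Gaussian operator on `sym p`, where `p = (k, x)` and
`y i = exp (-ν i)`. -/
def weight (y : ι → ℝ) (p : Conf ι) : ℝ := ∏ j, y (p.2 j)

/-- The occupation numbers of the one-particle basis vectors in the label `p`. -/
def occupation (p : Conf ι) : ι →₀ ℕ := ∑ j, Finsupp.single (p.2 j) 1

theorem weight_pos {y : ι → ℝ} (hy : ∀ i, 0 < y i) (p : Conf ι) : 0 < weight y p :=
  Finset.prod_pos fun _ _ => hy _

theorem weight_comp_perm (y : ι → ℝ) (p : Conf ι) (σ : Equiv.Perm (Fin p.1)) :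
    weight y ⟨p.1, p.2 ∘ σ⟩ = weight y p :=
  Equiv.prod_comp σ fun j => y (p.2 j)

theorem occupation_comp_perm (p : Conf ι) (σ : Equiv.Perm (Fin p.1)) :
    occupation ⟨p.1, p.2 ∘ σ⟩ = occupation p :=
  Equiv.sum_comp σ fun j => Finsupp.single (p.2 j) 1

theorem occupation_apply [DecidableEq ι] (p : Conf ι) (i : ι) :
    occupation p i = ∑ j, if p.2 j = i then 1 else 0 := by
  rw [occupation, Finsupp.finsetSum_apply]
  exact Finset.sum_congr rfl fun j _ => by rw [Finsupp.single_apply]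

theorem sum_occupation [DecidableEq ι] (p : Conf ι) (F : Finset ι) (hF : ∀ j, p.2 j ∈ F) :
    ∑ i ∈ F, occupation p i = p.1 := by
  simp only [occupation_apply]
  rw [Finset.sum_comm]
  simp [hF]

theorem sum_occupation_le [DecidableEq ι] (p : Conf ι) (F : Finset ι) :
    ∑ i ∈ F, occupation p i ≤ p.1 := by
  refine (Finset.sum_le_sum_of_subset
    (Finset.subset_union_left (s₂ := Finset.univ.image p.2))).trans
    (sum_occupation p _ fun j => ?_).le
  simp

theorem exp_neg_occupation (ν : ι → ℝ) (p : Conf ι) :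
    Real.exp (-((occupation p).sum fun i m => ν i * m)) = weight (fun i => Real.exp (-ν i)) p := by
  classical
  have h : (occupation p).sum (fun i m => ν i * m) = ∑ j, ν (p.2 j) := by
    rw [occupation, ← Finsupp.sum_finsetSum_index (by simp) (by intros; push_cast; ring)]
    simp
  rw [h, weight, ← Real.exp_sum, Finset.sum_neg_distrib]

variable {H : Type*} [NormedAddCommGroup H] [InnerProductSpace ℂ H] {η : ℤˣ}

theorem coord_number [DecidableEq ι] (e : HilbertBasis ι ℂ H) (i : ι) (f : FinFock η ι)
    (p : Conf ι) : coord (creation η e (e i) (annihilation η e (e i) f)) p =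
      (occupation p i : ℂ) * coord f p := by
  obtain ⟨k, x⟩ := p
  cases k with
  | zero => rw [coord_creation_zero]; simp [occupation]
  | succ k =>
    have hs : (Real.sqrt (k + 1) : ℂ) ≠ 0 := by
      rw [Complex.ofReal_ne_zero]; positivity
    rw [coord_creation_succ, occupation_apply]
    push_cast
    rw [Finset.mul_sum, Finset.sum_mul]
    refine Finset.sum_congr rfl fun j _ => ?_
    rw [(orthonormal_iff_ite.1 e.orthonormal), coord_annihilation_basis]
    split_ifs with h
    · subst h
      rw [coord_cons_succAbove]
      have h3 : eta η ^ (j : ℕ) * eta η ^ (j : ℕ) = 1 := by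
        rw [← mul_pow, eta_mul_self, one_pow]
      field_simp
      linear_combination coord f ⟨k + 1, x⟩ * h3
    · simp

/-- The vectors `sym p` are joint eigenvectors of the number operators. -/
theorem number_sym (e : HilbertBasis ι ℂ H) (i : ι) (p : Conf ι) :
    creation η e (e i) (annihilation η e (e i) (sym η p)) = (occupation p i : ℂ) • sym η p := by
  classical
  refine ext_coord fun k x => ?_
  rw [coord_number, coord_smul]
  by_cases h : coord (sym η p) ⟨k, x⟩ = 0
  · rw [h, mul_zero, mul_zero]
  · obtain ⟨σ, hσ⟩ := exists_perm_of_coord_sym_ne_zero h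
    rw [hσ, occupation_comp_perm]

theorem norm_annihilation_sym_sq (e : HilbertBasis ι ℂ H) (i : ι) (p : Conf ι) :
    ‖(annihilation η e (e i) (sym η p) : Fock η ι)‖ ^ 2 =
      occupation p i * ‖(sym η p : Fock η ι)‖ ^ 2 := by
  have h := inner_annihilation e (e i) (sym η p) (annihilation η e (e i) (sym η p))
  rw [number_sym] at h
  have h2 : ⟪(sym η p : Fock η ι), (((occupation p i : ℂ) • sym η p : FinFock η ι) : Fock η ι)⟫_ℂ =
      (occupation p i : ℂ) * ⟪(sym η p : Fock η ι), (sym η p : Fock η ι)⟫_ℂ :=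
    inner_smul_right_fock _ _ _
  rw [h2, inner_self_eq_norm_sq_to_K, inner_self_eq_norm_sq_to_K] at h
  apply Complex.ofReal_injective
  rw [Complex.ofReal_mul, Complex.ofReal_pow, Complex.ofReal_pow, Complex.ofReal_natCast]
  exact h

/-- Matrix elements of `a†(e i)` connect labels whose weights differ by the factor `y i`. -/
theorem weight_of_inner_creation_ne_zero (e : HilbertBasis ι ℂ H) (y : ι → ℝ) (i : ι)
    {p q : Conf ι} (h : ⟪(sym η p : Fock η ι), (creation η e (e i) (sym η q) : Fock η ι)⟫_ℂ ≠ 0) :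
    weight y p = y i * weight y q ∧ p.1 = q.1 + 1 := by
  classical
  rw [inner_sym] at h
  change coord (creation η e (e i) (sym η q)) p ≠ 0 at h
  obtain ⟨k, x⟩ := p
  cases k with
  | zero => exact absurd (coord_creation_zero _ _ _ _) h
  | succ k =>
    rw [coord_creation_succ] at h
    obtain ⟨j, -, hj⟩ := Finset.exists_ne_zero_of_sum_ne_zero (right_ne_zero_of_mul h)
    have h1 := left_ne_zero_of_mul (right_ne_zero_of_mul hj)
    have h2 := right_ne_zero_of_mul (right_ne_zero_of_mul hj)
    rw [(orthonormal_iff_ite.1 e.orthonormal)] at h1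
    have h3 : x j = i := by
      by_contra hc
      exact h1 (if_neg hc)
    obtain ⟨σ, hσ⟩ := exists_perm_of_coord_sym_ne_zero h2
    refine ⟨?_, ?_⟩
    · have h4 : weight y ⟨k, x ∘ j.succAbove⟩ = weight y q := by rw [hσ, weight_comp_perm]
      rw [← h4, ← h3]
      exact Fin.prod_univ_succAbove (fun m => y (x m)) j
    · have := congrArg Sigma.fst hσ
      simp only at this
      simp only [this]

/-- `exp (-∑ i, ν i a†_i a_i)` multiplies the vector `sym p` by `weight p`. -/
theorem IsExpNegNumber.apply_sym {e : HilbertBasis ι ℂ H} {ν : ι → ℝ} {G : Fock η ι →L[ℂ] Fock η ι}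
    (hG : IsExpNegNumber η e ν G) (p : Conf ι) :
    G (sym η p : Fock η ι) =
      (weight (fun i => Real.exp (-ν i)) p : ℂ) • (sym η p : Fock η ι) := by
  rw [← exp_neg_occupation]
  exact hG (occupation p) (sym η p) fun i => number_sym e i p

theorem IsExpNegNumber.coord {e : HilbertBasis ι ℂ H} {ν : ι → ℝ} {G : Fock η ι →L[ℂ] Fock η ι}
    (hG : IsExpNegNumber η e ν G) (f : Fock η ι) (p : Conf ι) :
    ⟪(sym η p : Fock η ι), G f⟫_ℂ =
      (weight (fun i => Real.exp (-ν i)) p : ℂ) * ⟪(sym η p : Fock η ι), f⟫_ℂ := by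
  have h1 := (hasSum_sym f).mapL (innerSL ℂ (sym η p : Fock η ι))
  have h2 := ((hasSum_sym f).mapL G).mapL (innerSL ℂ (sym η p : Fock η ι))
  refine h2.unique ((h1.mul_left _).congr_fun fun q => ?_)
  simp only [innerSL_apply_apply, map_smul, hG.apply_sym, smul_eq_mul]
  by_cases h : ⟪(sym η p : Fock η ι), (sym η q : Fock η ι)⟫_ℂ = 0
  · rw [h]; ring
  · rw [← inner_conj_symm, inner_sym] at h
    obtain ⟨σ, hσ⟩ := exists_perm_of_coord_sym_ne_zero (η := η) (p := p) (q := q) fun h' =>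
      h (by rw [show ((sym η p : Fock η ι) : FullFock ι) q = 0 from h', map_zero])
    rw [hσ, weight_comp_perm]
    ring

/-- The trace of the Gaussian operator is `∑ p, weight p ‖sym p‖²`. -/
theorem IsExpNegNumber.hasSum_weight {e : HilbertBasis ι ℂ H} {ν : ι → ℝ}
    {G : Fock η ι →L[ℂ] Fock η ι} (hG : IsExpNegNumber η e ν G) {Z : ℂ} (hZ : HasTrace G Z) :
    ∃ z : ℝ, Z = z ∧ HasSum (fun p : Conf ι => weight (fun i => Real.exp (-ν i)) p *
      ‖(sym η p : Fock η ι)‖ ^ 2) z := by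
  set y : ι → ℝ := fun i => Real.exp (-ν i) with hy
  have hpos : ∀ p, 0 < weight y p := weight_pos fun i => Real.exp_pos _
  obtain ⟨s, b, -⟩ := exists_hilbertBasis ℂ (Fock η ι)
  have h1 := hZ s b
  have h2 : ∀ i, HasSum (fun p : Conf ι => weight y p * ‖⟪b i, (sym η p : Fock η ι)⟫_ℂ‖ ^ 2)
      (⟪b i, G (b i)⟫_ℂ).re := by
    intro i
    refine (Complex.hasSum_re (hasSum_inner_sym (b i) (G (b i)))).congr_fun fun p => ?_
    rw [hG.coord, mul_left_comm, ← inner_conj_symm (sym η p : Fock η ι) (b i), Complex.mul_conj,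
      Complex.normSq_eq_norm_sq, ← Complex.ofReal_mul, Complex.ofReal_re]
  have h3 : Summable fun q : s × Conf ι =>
      weight y q.2 * ‖⟪b q.1, (sym η q.2 : Fock η ι)⟫_ℂ‖ ^ 2 := by
    rw [summable_prod_of_nonneg fun q => mul_nonneg (hpos _).le (by positivity)]
    refine ⟨fun i => (h2 i).summable, ?_⟩
    simp only [(h2 _).tsum_eq]
    exact (Complex.hasSum_re h1).summable
  have h4 : ∀ p : Conf ι, HasSum (fun i : s => weight y p * ‖⟪b i, (sym η p : Fock η ι)⟫_ℂ‖ ^ 2)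
      (weight y p * ‖(sym η p : Fock η ι)‖ ^ 2) := fun p =>
    (hasSum_norm_inner_sq b (sym η p : Fock η ι)).mul_left _
  have h5 := ((Equiv.prodComm (Conf ι) s).hasSum_iff.2 h3.hasSum).prod_fiberwise h4
  refine ⟨_, ?_, h5⟩
  have h6 := h3.hasSum.prod_fiberwise h2
  have h7 : ∀ i, ⟪b i, G (b i)⟫_ℂ = ((⟪b i, G (b i)⟫_ℂ).re : ℂ) := by
    intro i
    refine (hasSum_inner_sym (b i) (G (b i))).unique
      ((Complex.hasSum_ofReal.2 (h2 i)).congr_fun fun p => ?_)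
    rw [hG.coord, mul_left_comm, ← inner_conj_symm (sym η p : Fock η ι) (b i), Complex.mul_conj,
      Complex.normSq_eq_norm_sq, ← Complex.ofReal_mul]
  refine h1.unique ((Complex.hasSum_ofReal.2 h6).congr_fun fun i => ?_)
  exact h7 i

/-- Fubini's theorem behind `tsum_weight_cyclic`, for matrices `a` and `x` whose rows, respectively
columns, are square summable. -/
theorem tsum_tsum_weight_comm {α : Type*} (μ μ' : α → ℝ) (κ : ℂ) (a x : α → α → ℂ) (A X : α → ℝ)
    (hA : ∀ p, 0 ≤ A p) (hX : ∀ p, 0 ≤ X p) (ha : ∀ p, HasSum (fun q => ‖a p q‖ ^ 2) (A p ^ 2))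
    (hx : ∀ p, HasSum (fun q => ‖x q p‖ ^ 2) (X p ^ 2))
    (hpull : ∀ p q, a p q ≠ 0 → (μ p : ℂ) = κ * μ' q) (hs : Summable fun p => |μ p| * (A p * X p)) :
    ∑' p, (μ p : ℂ) * ∑' q, a p q * x q p = κ * ∑' q, (μ' q : ℂ) * ∑' p, x q p * a p q := by
  have h1 : ∀ p, (Summable fun q => ‖a p q‖ * ‖x q p‖) ∧ ∑' q, ‖a p q‖ * ‖x q p‖ ≤ A p * X p :=
    fun p => summable_mul_of_hasSum_sq (fun _ => norm_nonneg _) (fun _ => norm_nonneg _) (hA p)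
      (hX p) (ha p) (hx p)
  have hsum : Summable fun r : α × α => (μ r.1 : ℂ) * (a r.1 r.2 * x r.2 r.1) := by
    refine Summable.of_norm ?_
    rw [summable_prod_of_nonneg fun _ => norm_nonneg _]
    simp only [norm_mul, Complex.norm_real, Real.norm_eq_abs]
    refine ⟨fun p => (h1 p).1.mul_left _, Summable.of_nonneg_of_le
      (fun p => tsum_nonneg fun _ => by positivity) (fun p => ?_) hs⟩
    rw [tsum_mul_left]
    exact mul_le_mul_of_nonneg_left (h1 p).2 (abs_nonneg _)
  have hL : ∑' p, (μ p : ℂ) * ∑' q, a p q * x q p =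
      ∑' p, ∑' q, (μ p : ℂ) * (a p q * x q p) :=
    tsum_congr fun p => tsum_mul_left.symm
  have hR : κ * ∑' q, (μ' q : ℂ) * ∑' p, x q p * a p q =
      ∑' q, ∑' p, (μ p : ℂ) * (a p q * x q p) := by
    rw [← tsum_mul_left]
    refine tsum_congr fun q => ?_
    rw [← tsum_mul_left, ← tsum_mul_left]
    refine tsum_congr fun p => ?_
    by_cases h : a p q = 0
    · rw [h]; ring
    · rw [hpull p q h]; ring
  rw [hL, hR]
  exact (Summable.tsum_comm hsum).symm

/-- Cyclicity of the weighted trace `∑ p, μ p ⟪sym p, · sym p⟫` for an operator `A` whose matrix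
elements intertwine the weights `μ` and `κ μ'`: insert a resolution of the identity and interchange
the two sums. -/
theorem tsum_weight_cyclic (μ μ' : Conf ι → ℝ) (κ : ℂ) {A A' X X' : Module.End ℂ (FinFock η ι)}
    (hA : ∀ f g : FinFock η ι,
      ⟪(A' f : Fock η ι), (g : Fock η ι)⟫_ℂ = ⟪(f : Fock η ι), (A g : Fock η ι)⟫_ℂ)
    (hX : ∀ f g : FinFock η ι,
      ⟪(X' f : Fock η ι), (g : Fock η ι)⟫_ℂ = ⟪(f : Fock η ι), (X g : Fock η ι)⟫_ℂ)
    (hpull : ∀ p q, ⟪(sym η p : Fock η ι), (A (sym η q) : Fock η ι)⟫_ℂ ≠ 0 → (μ p : ℂ) = κ * μ' q)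
    (hs : Summable fun p => |μ p| *
      (‖(A' (sym η p) : Fock η ι)‖ * ‖(X (sym η p) : Fock η ι)‖)) :
    ∑' p, (μ p : ℂ) * ⟪(sym η p : Fock η ι), (A (X (sym η p)) : Fock η ι)⟫_ℂ =
      κ * ∑' q, (μ' q : ℂ) * ⟪(sym η q : Fock η ι), (X (A (sym η q)) : Fock η ι)⟫_ℂ := by
  have hn : ∀ (f : Fock η ι), HasSum (fun q : Conf ι => ‖⟪(sym η q : Fock η ι), f⟫_ℂ‖ ^ 2)
      (‖f‖ ^ 2) := fun f => (hasSum_norm_sq f).congr_fun fun q => by rw [inner_sym]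
  have h := tsum_tsum_weight_comm μ μ' κ
    (fun p q => ⟪(A' (sym η p) : Fock η ι), (sym η q : Fock η ι)⟫_ℂ)
    (fun q p => ⟪(sym η q : Fock η ι), (X (sym η p) : Fock η ι)⟫_ℂ)
    (fun p => ‖(A' (sym η p) : Fock η ι)‖) (fun p => ‖(X (sym η p) : Fock η ι)‖)
    (fun _ => norm_nonneg _) (fun _ => norm_nonneg _)
    (fun p => (hn (A' (sym η p) : Fock η ι)).congr_fun fun q => by rw [norm_inner_symm])
    (fun p => hn (X (sym η p) : Fock η ι))
    (fun p q hpq => hpull p q (by rwa [← hA])) hs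
  refine Eq.trans (tsum_congr fun p => ?_) (h.trans ?_)
  · rw [← hA, ← (hasSum_inner_sym (A' (sym η p) : Fock η ι) _).tsum_eq]
  · congr 1
    refine tsum_congr fun q => ?_
    rw [← hX, ← (hasSum_inner_sym (X' (sym η q) : Fock η ι) _).tsum_eq]
    simp only [hA, hX]

end Weight

/-! ### Moments of the particle number -/

section Moments

variable {ι H : Type*} [NormedAddCommGroup H] [InnerProductSpace ℂ H] {η : ℤˣ}

theorem occupation_le (p : Conf ι) (i : ι) : occupation p i ≤ p.1 := by
  classical
  simpa using sum_occupation_le p {i}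

theorem inner_number_sym (e : HilbertBasis ι ℂ H) (i : ι) (p : Conf ι) :
    ⟪(sym η p : Fock η ι), (creation η e (e i) (annihilation η e (e i) (sym η p)) : Fock η ι)⟫_ℂ =
      ((occupation p i * ‖(sym η p : Fock η ι)‖ ^ 2 : ℝ) : ℂ) := by
  rw [← inner_annihilation, inner_self_eq_norm_sq_to_K, ← norm_annihilation_sym_sq e]
  rw [Complex.ofReal_pow]
  rfl

theorem inner_annihilation_creation_sym (e : HilbertBasis ι ℂ H) (i : ι) (p : Conf ι) :
    ⟪(sym η p : Fock η ι), (annihilation η e (e i) (creation η e (e i) (sym η p)) : Fock η ι)⟫_ℂ =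
      (((1 + ((η : ℤ) : ℝ) * occupation p i) * ‖(sym η p : Fock η ι)‖ ^ 2 : ℝ) : ℂ) := by
  have h1 : ⟪e i, e i⟫_ℂ = 1 := by
    classical
    rw [(orthonormal_iff_ite.1 e.orthonormal), if_pos rfl]
  have h := congrArg (fun O : Module.End ℂ (FinFock η ι) =>
    ⟪(sym η p : Fock η ι), (O (sym η p) : Fock η ι)⟫_ℂ)
    (annihilation_mul_creation (η := η) e (e i) (e i))
  rw [h1] at h
  have h2 : ⟪(sym η p : Fock η ι),
      (annihilation η e (e i) (creation η e (e i) (sym η p)) : Fock η ι)⟫_ℂ =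
      ⟪(sym η p : Fock η ι), eta η • (creation η e (e i) (annihilation η e (e i) (sym η p)) :
        Fock η ι) + (1 : ℂ) • (sym η p : Fock η ι)⟫_ℂ := h
  rw [h2, inner_add_right, inner_smul_right_fock, inner_smul_right_fock, inner_number_sym,
    inner_self_eq_norm_sq_to_K]
  simp only [eta]
  push_cast
  simp only [Complex.coe_algebraMap]
  ring

theorem one_add_eta_mul_occupation_nonneg (e : HilbertBasis ι ℂ H) (i : ι) (p : Conf ι) :
    0 ≤ (1 + ((η : ℤ) : ℝ) * occupation p i) * ‖(sym η p : Fock η ι)‖ ^ 2 := by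
  have h := inner_annihilation_creation_sym (η := η) e i p
  rw [← inner_creation, inner_self_eq_norm_sq_to_K] at h
  have h2 : (((‖(creation η e (e i) (sym η p) : Fock η ι)‖ ^ 2 : ℝ)) : ℂ) = _ :=
    (Complex.ofReal_pow _ _).trans h
  rw [← Complex.ofReal_injective h2]
  positivity

theorem summable_of_summable_weight {y : ι → ℝ}
    (hw : Summable fun p : Conf ι => weight y p * ‖(sym η p : Fock η ι)‖ ^ 2) : Summable y := by
  have hinj : Function.Injective fun i : ι => (⟨1, fun _ => i⟩ : Conf ι) := fun i j h =>
    congrFun (mk_eq_mk_iff.1 h) 0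
  refine (hw.comp_injective hinj).congr fun i => ?_
  rw [Function.comp_apply, norm_sym_of_le_one η _ le_rfl]
  simp [weight]

theorem lt_one_of_summable_weight {y : ι → ℝ}
    (hw : Summable fun p : Conf ι => weight y p * ‖(sym 1 p : Fock 1 ι)‖ ^ 2) (i : ι) :
    |y i| < 1 := by
  have hinj : Function.Injective fun k : ℕ => (⟨k, fun _ => i⟩ : Conf ι) := fun k l h =>
    congrArg Sigma.fst h
  have h : Summable fun k : ℕ => y i ^ k := by
    refine (hw.comp_injective hinj).congr fun k => ?_
    rw [Function.comp_apply, norm_sym_const]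
    simp [weight]
  exact summable_geometric_iff_norm_lt_one.1 h

theorem exists_lt_one_forall_le {y : ι → ℝ} (hs : Summable y) (h1 : ∀ i, y i < 1) :
    ∃ q, 0 < q ∧ q < 1 ∧ ∀ i, y i ≤ q := by
  classical
  have hfin : {i | ¬ y i < 1 / 2}.Finite :=
    (hs.tendsto_cofinite_zero.eventually (gt_mem_nhds (by norm_num : (0 : ℝ) < 1 / 2)))
  rcases hfin.toFinset.eq_empty_or_nonempty with h | h
  · refine ⟨1 / 2, by norm_num, by norm_num, fun i => ?_⟩
    by_contra hc
    have : i ∈ hfin.toFinset := by simp; linarith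
    rw [h] at this
    simp at this
  · obtain ⟨i0, -, hi0⟩ := hfin.toFinset.exists_max_image y h
    refine ⟨max (1 / 2) (y i0), by positivity, max_lt (by norm_num) (h1 i0), fun i => ?_⟩
    by_cases hi : y i < 1 / 2
    · exact hi.le.trans (le_max_left _ _)
    · exact (hi0 i (by simpa using hi)).trans (le_max_right _ _)

/-- A growth rate `r > 1` for which the occupation of a mode, in the ensemble reweighted by
`r ^ (number of particles)`, is controlled by `y i`. For bosons this uses `y i ≤ q < 1`. -/
theorem exists_growth_rate {y : ι → ℝ} (hy : ∀ i, 0 < y i)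
    (hw : Summable fun p : Conf ι => weight y p * ‖(sym η p : Fock η ι)‖ ^ 2) :
    ∃ r c : ℝ, 1 < r ∧ 0 ≤ c ∧ ∀ i T U, 0 ≤ T → 0 ≤ U →
      T ≤ r * y i * (U + ((η : ℤ) : ℝ) * T) → T ≤ c * y i * U := by
  rcases Int.units_eq_one_or η with rfl | rfl
  · obtain ⟨q, hq0, hq1, hq⟩ := exists_lt_one_forall_le (summable_of_summable_weight hw)
      fun i => (le_abs_self _).trans_lt (lt_one_of_summable_weight hw i)
    refine ⟨(1 + q) / (2 * q), (1 + q) / (2 * q) / (1 - (1 + q) / 2), ?_, ?_, ?_⟩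
    · rw [lt_div_iff₀ (by positivity)]; linarith
    · exact div_nonneg (by positivity) (by linarith)
    · intro i T U hT hU h
      have h1 : (1 + q) / (2 * q) * y i ≤ (1 + q) / 2 := by
        calc (1 + q) / (2 * q) * y i ≤ (1 + q) / (2 * q) * q := by gcongr; exact hq i
          _ = _ := by field_simp
      have h2 : 0 < 1 - (1 + q) / 2 := by linarith
      simp only [Units.val_one, Int.cast_one, one_mul] at h
      rw [div_mul_eq_mul_div, div_mul_eq_mul_div, le_div_iff₀ h2]
      nlinarith [mul_le_mul_of_nonneg_right h1 hT]
  · refine ⟨2, 2, by norm_num, by norm_num, fun i T U hT hU h => ?_⟩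
    simp only [Units.val_neg, Units.val_one, Int.cast_neg, Int.cast_one] at h
    nlinarith [mul_nonneg (hy i).le hT]

/-- The geometric weight `r ^ k` of the `k`-particle sector, cut off at `K` particles. -/
def cutoff (r : ℝ) (K k : ℕ) : ℝ := if k ≤ K then r ^ k else 0

theorem cutoff_nonneg {r : ℝ} (hr : 1 < r) (K k : ℕ) : 0 ≤ cutoff r K k := by
  unfold cutoff; split_ifs <;> positivity

theorem cutoff_le {r : ℝ} (hr : 1 < r) (K k : ℕ) : cutoff r K k ≤ r ^ K := by
  unfold cutoff
  split_ifs with h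
  · exact pow_le_pow_right₀ hr.le h
  · positivity

theorem cutoff_le_pow {r : ℝ} (hr : 1 < r) (K k : ℕ) : cutoff r K k ≤ r ^ k := by
  unfold cutoff
  split_ifs with h
  · exact le_rfl
  · positivity

theorem cutoff_mul_le {r : ℝ} (hr : 1 < r) (K k : ℕ) : cutoff r K k * k ≤ r ^ K * K := by
  unfold cutoff
  split_ifs with h
  · gcongr
    exact hr.le
  · rw [zero_mul]; positivity

theorem cutoff_succ_le {r : ℝ} (hr : 1 < r) (K k : ℕ) :
    cutoff r K (k + 1) ≤ r * cutoff r K k := by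
  unfold cutoff
  split_ifs with h h'
  · rw [pow_succ, mul_comm]
  · omega
  · positivity
  · simp

variable {y : ι → ℝ}

theorem summable_cutoff_mul (hy : ∀ i, 0 < y i)
    (hw : Summable fun p : Conf ι => weight y p * ‖(sym η p : Fock η ι)‖ ^ 2) {r : ℝ} (hr : 1 < r)
    (K : ℕ) (g : Conf ι → ℝ) (hg0 : ∀ p, 0 ≤ g p) (hg : ∀ p, g p ≤ p.1) :
    Summable fun p : Conf ι =>
      cutoff r K p.1 * g p * (weight y p * ‖(sym η p : Fock η ι)‖ ^ 2) := by
  have hw0 : ∀ p : Conf ι, 0 ≤ weight y p * ‖(sym η p : Fock η ι)‖ ^ 2 := fun p =>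
    mul_nonneg (weight_pos hy p).le (by positivity)
  refine Summable.of_nonneg_of_le (fun p => mul_nonneg (mul_nonneg (cutoff_nonneg hr _ _) (hg0 p))
    (hw0 p)) (fun p => ?_) (hw.mul_left (r ^ K * K))
  refine mul_le_mul_of_nonneg_right ?_ (hw0 p)
  exact (mul_le_mul_of_nonneg_left (hg p) (cutoff_nonneg hr _ _)).trans (cutoff_mul_le hr _ _)

theorem summable_cutoff (hy : ∀ i, 0 < y i)
    (hw : Summable fun p : Conf ι => weight y p * ‖(sym η p : Fock η ι)‖ ^ 2) {r : ℝ} (hr : 1 < r)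
    (K : ℕ) : Summable fun p : Conf ι =>
      cutoff r K p.1 * (weight y p * ‖(sym η p : Fock η ι)‖ ^ 2) := by
  have hw0 : ∀ p : Conf ι, 0 ≤ weight y p * ‖(sym η p : Fock η ι)‖ ^ 2 := fun p =>
    mul_nonneg (weight_pos hy p).le (by positivity)
  exact Summable.of_nonneg_of_le (fun p => mul_nonneg (cutoff_nonneg hr _ _) (hw0 p))
    (fun p => mul_le_mul_of_nonneg_right (cutoff_le hr _ _) (hw0 p)) (hw.mul_left (r ^ K))

/-- Cyclicity applied to `a†_i a_i` bounds the occupation of the mode `i` in the reweighted and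
truncated ensemble. -/
theorem tsum_cutoff_occupation_le (e : HilbertBasis ι ℂ H) (hy : ∀ i, 0 < y i)
    (hw : Summable fun p : Conf ι => weight y p * ‖(sym η p : Fock η ι)‖ ^ 2) {r : ℝ} (hr : 1 < r)
    (K : ℕ) (i : ι) :
    ∑' p : Conf ι, cutoff r K p.1 * occupation p i * (weight y p * ‖(sym η p : Fock η ι)‖ ^ 2) ≤
      r * y i * (∑' p : Conf ι, cutoff r K p.1 * (weight y p * ‖(sym η p : Fock η ι)‖ ^ 2) +
        ((η : ℤ) : ℝ) * ∑' p : Conf ι,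
          cutoff r K p.1 * occupation p i * (weight y p * ‖(sym η p : Fock η ι)‖ ^ 2)) := by
  have hw0 : ∀ p : Conf ι, 0 ≤ weight y p * ‖(sym η p : Fock η ι)‖ ^ 2 := fun p =>
    mul_nonneg (weight_pos hy p).le (by positivity)
  have hsT := summable_cutoff_mul hy hw hr K (fun p => occupation p i) (fun p => by positivity)
    (fun p => by exact_mod_cast occupation_le p i)
  have hsU := summable_cutoff hy hw hr K
  have h := tsum_weight_cyclic (η := η) (fun p => cutoff r K p.1 * weight y p)
    (fun q => cutoff r K (q.1 + 1) * weight y q) (y i) (A := creation η e (e i))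
    (A' := annihilation η e (e i)) (X := annihilation η e (e i)) (X' := creation η e (e i))
    (inner_annihilation e (e i)) (inner_creation e (e i))
    (fun p q hpq => by
      obtain ⟨h1, h2⟩ := weight_of_inner_creation_ne_zero e y i hpq
      rw [h1, h2]
      push_cast
      ring)
    (by
      refine hsT.congr fun p => ?_
      rw [abs_of_nonneg (mul_nonneg (cutoff_nonneg hr _ _) (weight_pos hy p).le), ← sq,
        norm_annihilation_sym_sq]
      ring)
  simp only [inner_number_sym, inner_annihilation_creation_sym, ← Complex.ofReal_mul,
    ← Complex.ofReal_tsum] at h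
  have h' := Complex.ofReal_injective h
  have hsB : Summable fun p : Conf ι => cutoff r K p.1 * (weight y p *
      ((1 + ((η : ℤ) : ℝ) * occupation p i) * ‖(sym η p : Fock η ι)‖ ^ 2)) :=
    (hsU.add (hsT.mul_left ((η : ℤ) : ℝ))).congr fun p => by ring
  have hb0 : ∀ p : Conf ι, 0 ≤ weight y p *
      ((1 + ((η : ℤ) : ℝ) * occupation p i) * ‖(sym η p : Fock η ι)‖ ^ 2) := fun p =>
    mul_nonneg (weight_pos hy p).le (one_add_eta_mul_occupation_nonneg e i p)
  have hle : ∀ p : Conf ι, cutoff r K (p.1 + 1) * weight y p *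
      ((1 + ((η : ℤ) : ℝ) * occupation p i) * ‖(sym η p : Fock η ι)‖ ^ 2) ≤
      r * (cutoff r K p.1 * (weight y p *
      ((1 + ((η : ℤ) : ℝ) * occupation p i) * ‖(sym η p : Fock η ι)‖ ^ 2))) := by
    intro p
    rw [mul_assoc, ← mul_assoc r]
    exact mul_le_mul_of_nonneg_right (cutoff_succ_le hr _ _) (hb0 p)
  have hsA : Summable fun p : Conf ι => cutoff r K (p.1 + 1) * weight y p *
      ((1 + ((η : ℤ) : ℝ) * occupation p i) * ‖(sym η p : Fock η ι)‖ ^ 2) :=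
    Summable.of_nonneg_of_le (fun p => by
      rw [mul_assoc]; exact mul_nonneg (cutoff_nonneg hr _ _) (hb0 p)) hle (hsB.mul_left r)
  calc _ = ∑' p : Conf ι, cutoff r K p.1 * weight y p *
        (occupation p i * ‖(sym η p : Fock η ι)‖ ^ 2) := tsum_congr fun p => by ring
    _ = _ := h'
    _ ≤ y i * ∑' p : Conf ι, r * (cutoff r K p.1 * (weight y p *
      ((1 + ((η : ℤ) : ℝ) * occupation p i) * ‖(sym η p : Fock η ι)‖ ^ 2))) :=
        mul_le_mul_of_nonneg_left (hsA.tsum_le_tsum hle (hsB.mul_left r)) (hy i).le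
    _ = _ := by
        rw [tsum_mul_left, ← tsum_mul_left (a := ((η : ℤ) : ℝ)),
          ← hsU.tsum_add (hsT.mul_left ((η : ℤ) : ℝ)), ← mul_assoc, mul_comm (y i) r]
        congr 1
        exact tsum_congr fun p => by ring

/-- If `∑ p, weight p ‖sym p‖²` converges, it still does after multiplication by
`r ^ (number of particles)`, for some `r > 1`. -/
theorem exists_summable_pow_mul_weight (e : HilbertBasis ι ℂ H) (hy : ∀ i, 0 < y i)
    (hw : Summable fun p : Conf ι => weight y p * ‖(sym η p : Fock η ι)‖ ^ 2) :
    ∃ r : ℝ, 1 < r ∧ Summable fun p : Conf ι =>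
      r ^ p.1 * (weight y p * ‖(sym η p : Fock η ι)‖ ^ 2) := by
  classical
  obtain ⟨r, c, hr, hc, hrc⟩ := exists_growth_rate hy hw
  have hys := summable_of_summable_weight hw
  have hw0 : ∀ p : Conf ι, 0 ≤ weight y p * ‖(sym η p : Fock η ι)‖ ^ 2 := fun p =>
    mul_nonneg (weight_pos hy p).le (by positivity)
  set w : Conf ι → ℝ := fun p => weight y p * ‖(sym η p : Fock η ι)‖ ^ 2 with hwdef
  set S := ∑' i, y i with hS
  obtain ⟨m, hm⟩ := exists_nat_ge (2 * (c * S) + 1)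
  have hS0 : 0 ≤ S := tsum_nonneg fun i => (hy i).le
  have hm0 : (0 : ℝ) < m := by nlinarith [mul_nonneg hc hS0]
  have key : ∀ K : ℕ, ∑' p, cutoff r K p.1 * w p ≤ 2 * (r ^ m * ∑' p, w p) := by
    intro K
    have hsU : Summable fun p : Conf ι => cutoff r K p.1 * w p := summable_cutoff hy hw hr K
    have hsN : Summable fun p : Conf ι => cutoff r K p.1 * (p.1 : ℝ) * w p :=
      summable_cutoff_mul hy hw hr K (fun p => p.1) (fun p => by positivity) (fun p => le_rfl)
    have hsT : ∀ i, Summable fun p : Conf ι => cutoff r K p.1 * occupation p i * w p := fun i =>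
      summable_cutoff_mul hy hw hr K (fun p => occupation p i) (fun p => by positivity)
        (fun p => by exact_mod_cast occupation_le p i)
    set U := ∑' p, cutoff r K p.1 * w p with hU
    have hU0 : 0 ≤ U := tsum_nonneg fun p => mul_nonneg (cutoff_nonneg hr _ _) (hw0 p)
    have hT0 : ∀ (i : ι) (p : Conf ι), 0 ≤ cutoff r K p.1 * occupation p i * w p := fun i p =>
      mul_nonneg (mul_nonneg (cutoff_nonneg hr _ _) (Nat.cast_nonneg _)) (hw0 p)
    have hT : ∀ i, ∑' p : Conf ι, cutoff r K p.1 * occupation p i * w p ≤ c * y i * U := fun i =>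
      hrc i _ _ (tsum_nonneg (hT0 i)) hU0 (tsum_cutoff_occupation_le e hy hw hr K i)
    -- Summing the bound on the occupations over the modes bounds the mean particle number.
    have hN : ∑' p : Conf ι, cutoff r K p.1 * (p.1 : ℝ) * w p ≤ c * S * U := by
      refine hsN.tsum_le_of_sum_le fun s => ?_
      set F : Finset ι := s.biUnion fun p => Finset.univ.image p.2 with hF
      calc ∑ p ∈ s, cutoff r K p.1 * (p.1 : ℝ) * w p
          = ∑ p ∈ s, ∑ i ∈ F, cutoff r K p.1 * occupation p i * w p := by
            refine Finset.sum_congr rfl fun p hp => ?_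
            rw [← Finset.sum_mul, ← Finset.mul_sum, ← Nat.cast_sum, sum_occupation]
            intro j
            rw [hF, Finset.mem_biUnion]
            exact ⟨p, hp, by simp⟩
        _ = ∑ i ∈ F, ∑ p ∈ s, cutoff r K p.1 * occupation p i * w p := Finset.sum_comm
        _ ≤ ∑ i ∈ F, c * y i * U := Finset.sum_le_sum fun i _ =>
            ((hsT i).sum_le_tsum s fun p _ => hT0 i p).trans (hT i)
        _ = c * (∑ i ∈ F, y i) * U := by rw [Finset.mul_sum, Finset.sum_mul]
        _ ≤ c * S * U := by
            gcongr
            exact hys.sum_le_tsum F fun i _ => (hy i).le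
    -- Sectors with more than `m` particles contribute at most the mean particle number over `m`;
    -- `m` was chosen such that this is at most `U / 2`.
    have hUle : U ≤ r ^ m * ∑' p, w p + (∑' p : Conf ι, cutoff r K p.1 * (p.1 : ℝ) * w p) / m := by
      rw [← tsum_mul_left, ← tsum_div_const, ← (hw.mul_left _).tsum_add (hsN.div_const _)]
      refine hsU.tsum_le_tsum (fun p => ?_) ((hw.mul_left _).add (hsN.div_const _))
      have h1 : cutoff r K p.1 ≤ r ^ m + cutoff r K p.1 * p.1 / m := by
        have h0 := cutoff_nonneg hr K p.1
        by_cases h : p.1 ≤ m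
        · have h2 := (cutoff_le_pow hr K p.1).trans (pow_le_pow_right₀ hr.le h)
          have h3 : 0 ≤ cutoff r K p.1 * p.1 / m := by positivity
          linarith
        · have h2 : cutoff r K p.1 ≤ cutoff r K p.1 * p.1 / m := by
            rw [le_div_iff₀ hm0]
            have : (m : ℝ) ≤ p.1 := by exact_mod_cast (not_le.1 h).le
            gcongr
          have h3 : 0 ≤ r ^ m := by positivity
          linarith
      calc _ ≤ (r ^ m + cutoff r K p.1 * p.1 / m) * w p := mul_le_mul_of_nonneg_right h1 (hw0 p)
        _ = _ := by ring
    have hhalf : (∑' p : Conf ι, cutoff r K p.1 * (p.1 : ℝ) * w p) / m ≤ U / 2 := by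
      rw [div_le_div_iff₀ hm0 two_pos]
      nlinarith
    linarith
  refine ⟨r, hr, summable_of_sum_le (c := 2 * (r ^ m * ∑' p, w p))
    (fun p => mul_nonneg (by positivity) (hw0 p)) fun s => ?_⟩
  obtain ⟨K, hK⟩ : ∃ K : ℕ, ∀ p ∈ s, p.1 ≤ K :=
    ⟨s.sup fun p => p.1, fun p hp => Finset.le_sup (f := fun p : Conf ι => p.1) hp⟩
  calc ∑ p ∈ s, r ^ p.1 * w p = ∑ p ∈ s, cutoff r K p.1 * w p :=
        Finset.sum_congr rfl fun p hp => by rw [cutoff, if_pos (hK p hp)]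
    _ ≤ _ := (summable_cutoff hy hw hr K).sum_le_tsum s fun p _ =>
        mul_nonneg (cutoff_nonneg hr _ _) (hw0 p)
    _ ≤ _ := key K

/-- All moments of the particle number are finite. -/
theorem summable_moment (e : HilbertBasis ι ℂ H) (hy : ∀ i, 0 < y i)
    (hw : Summable fun p : Conf ι => weight y p * ‖(sym η p : Fock η ι)‖ ^ 2) (m : ℕ) :
    Summable fun p : Conf ι =>
      ((p.1 : ℝ) + 1) ^ m * (weight y p * ‖(sym η p : Fock η ι)‖ ^ 2) := by
  obtain ⟨r, hr, hs⟩ := exists_summable_pow_mul_weight e hy hw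
  obtain ⟨B, hB⟩ := (tendsto_pow_const_div_const_pow_of_one_lt m hr).bddAbove_range
  refine Summable.of_nonneg_of_le (fun p => mul_nonneg (by positivity)
    (mul_nonneg (weight_pos hy p).le (by positivity))) (fun p => ?_) (hs.mul_left (B * r))
  rw [← mul_assoc (B * r)]
  refine mul_le_mul_of_nonneg_right ?_ (mul_nonneg (weight_pos hy p).le (by positivity))
  have h := hB ⟨p.1 + 1, rfl⟩
  simp only at h
  rw [div_le_iff₀ (by positivity)] at h
  push_cast at h
  rw [pow_succ] at h
  linarith

end Moments

/-! ### The Gaussian state -/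

section State

variable {ι H : Type*} [NormedAddCommGroup H] [InnerProductSpace ℂ H] {η : ℤˣ} {y : ι → ℝ}

theorem PolyBounded.exists_norm_sym_le {O : Module.End ℂ (FinFock η ι)} (h : PolyBounded O) :
    ∃ (m : ℕ) (C : ℝ), 0 ≤ C ∧ ∀ p : Conf ι,
      ‖(O (sym η p) : Fock η ι)‖ ≤ C * ((p.1 : ℝ) + 1) ^ m * ‖(sym η p : Fock η ι)‖ := by
  obtain ⟨d, m, C, hC, h⟩ := h
  exact ⟨m, C, hC, fun p => (h p.1 _ (particlesLE_sym p)).2⟩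

theorem summable_weight_norm_apply (e : HilbertBasis ι ℂ H) (hy : ∀ i, 0 < y i)
    (hw : Summable fun p : Conf ι => weight y p * ‖(sym η p : Fock η ι)‖ ^ 2)
    {O O' : Module.End ℂ (FinFock η ι)} (h : PolyBounded O) (h' : PolyBounded O') :
    Summable fun p : Conf ι => weight y p *
      (‖(O (sym η p) : Fock η ι)‖ * ‖(O' (sym η p) : Fock η ι)‖) := by
  obtain ⟨m, C, hC, h⟩ := h.exists_norm_sym_le
  obtain ⟨m', C', hC', h'⟩ := h'.exists_norm_sym_le
  refine Summable.of_nonneg_of_le (fun p => mul_nonneg (weight_pos hy p).le (by positivity))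
    (fun p => ?_) ((summable_moment e hy hw (m + m')).mul_left (C * C'))
  calc _ ≤ weight y p * ((C * ((p.1 : ℝ) + 1) ^ m * ‖(sym η p : Fock η ι)‖) *
        (C' * ((p.1 : ℝ) + 1) ^ m' * ‖(sym η p : Fock η ι)‖)) := by
        refine mul_le_mul_of_nonneg_left ?_ (weight_pos hy p).le
        exact mul_le_mul (h p) (h' p) (norm_nonneg _) (by positivity)
    _ = _ := by ring

theorem summable_weight_inner (e : HilbertBasis ι ℂ H) (hy : ∀ i, 0 < y i)
    (hw : Summable fun p : Conf ι => weight y p * ‖(sym η p : Fock η ι)‖ ^ 2)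
    {O : Module.End ℂ (FinFock η ι)} (h : PolyBounded O) :
    Summable fun p : Conf ι =>
      (weight y p : ℂ) * ⟪(sym η p : Fock η ι), (O (sym η p) : Fock η ι)⟫_ℂ := by
  have h1 : PolyBounded (1 : Module.End ℂ (FinFock η ι)) := by
    simpa using PolyBounded.smul_one (η := η) (ι := ι) 1
  refine Summable.of_norm_bounded (summable_weight_norm_apply e hy hw h1 h) fun p => ?_
  rw [norm_mul, Complex.norm_real, Real.norm_of_nonneg (weight_pos hy p).le]
  exact mul_le_mul_of_nonneg_left (norm_inner_le_norm _ _) (weight_pos hy p).le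

/-- The unnormalized expectation `tr (exp (-∑ i, ν i a†_i a_i) O)`, computed with the overcomplete
family `sym p`; here `y i = exp (-ν i)`. -/
def gibbsSum (y : ι → ℝ) (O : Module.End ℂ (FinFock η ι)) : ℂ :=
  ∑' p : Conf ι, (weight y p : ℂ) * ⟪(sym η p : Fock η ι), (O (sym η p) : Fock η ι)⟫_ℂ

theorem gibbsSum_add (e : HilbertBasis ι ℂ H) (hy : ∀ i, 0 < y i)
    (hw : Summable fun p : Conf ι => weight y p * ‖(sym η p : Fock η ι)‖ ^ 2)
    {A B : Module.End ℂ (FinFock η ι)} (hA : PolyBounded A) (hB : PolyBounded B) :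
    gibbsSum y (A + B) = gibbsSum y A + gibbsSum y B := by
  rw [gibbsSum, gibbsSum, gibbsSum,
    ← (summable_weight_inner e hy hw hA).tsum_add (summable_weight_inner e hy hw hB)]
  refine tsum_congr fun p => ?_
  rw [← mul_add, ← inner_add_right]
  rfl

theorem gibbsSum_smul (c : ℂ) (A : Module.End ℂ (FinFock η ι)) :
    gibbsSum y (c • A) = c * gibbsSum y A := by
  rw [gibbsSum, gibbsSum, ← tsum_mul_left]
  refine tsum_congr fun p => ?_
  rw [mul_left_comm, ← inner_smul_right_fock _ _ c]
  rfl

theorem gibbsSum_one {z : ℝ}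
    (hz : HasSum (fun p : Conf ι => weight y p * ‖(sym η p : Fock η ι)‖ ^ 2) z) :
    gibbsSum y (1 : Module.End ℂ (FinFock η ι)) = z := by
  rw [← hz.tsum_eq, Complex.ofReal_tsum, gibbsSum]
  refine tsum_congr fun p => ?_
  rw [Complex.ofReal_mul, Complex.ofReal_pow]
  exact congrArg _ (inner_self_eq_norm_sq_to_K (sym η p : Fock η ι))

/-- Expectations of `A v * X` are bounded in `v` if the adjoint of `A v` satisfies the estimate of
a ladder operator. -/
theorem exists_norm_gibbsSum_le (e : HilbertBasis ι ℂ H) (hy : ∀ i, 0 < y i)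
    (hw : Summable fun p : Conf ι => weight y p * ‖(sym η p : Fock η ι)‖ ^ 2)
    {X : Module.End ℂ (FinFock η ι)} (hX : PolyBounded X)
    (A A' : H → Module.End ℂ (FinFock η ι))
    (hadj : ∀ v (f g : FinFock η ι), ⟪(A' v f : Fock η ι), (g : Fock η ι)⟫_ℂ =
      ⟪(f : Fock η ι), (A v g : Fock η ι)⟫_ℂ)
    (hle : ∀ v (p : Conf ι), ‖(A' v (sym η p) : Fock η ι)‖ ≤
      Real.sqrt (p.1 + 1) * ‖v‖ * ‖(sym η p : Fock η ι)‖) :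
    ∃ C : ℝ, ∀ v, ‖gibbsSum y (A v * X)‖ ≤ C * ‖v‖ := by
  obtain ⟨m, C, hC, hXC⟩ := hX.exists_norm_sym_le
  have hm := summable_moment e hy hw (m + 1)
  refine ⟨C * ∑' p : Conf ι, ((p.1 : ℝ) + 1) ^ (m + 1) * (weight y p *
    ‖(sym η p : Fock η ι)‖ ^ 2), fun v => ?_⟩
  rw [gibbsSum, mul_right_comm, ← tsum_mul_left]
  refine tsum_of_norm_bounded (hm.mul_left _).hasSum fun p => ?_
  rw [norm_mul, Complex.norm_real, Real.norm_of_nonneg (weight_pos hy p).le]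
  have h1 : ‖⟪(sym η p : Fock η ι), (A v (X (sym η p)) : Fock η ι)⟫_ℂ‖ ≤
      (((p.1 : ℝ) + 1) * ‖v‖ * ‖(sym η p : Fock η ι)‖) *
        (C * ((p.1 : ℝ) + 1) ^ m * ‖(sym η p : Fock η ι)‖) := by
    rw [← hadj]
    refine (norm_inner_le_norm _ _).trans (mul_le_mul ((hle v p).trans ?_) (hXC p)
      (norm_nonneg _) (by positivity))
    gcongr
    exact sqrt_le_add_one _
  calc _ ≤ weight y p * ((((p.1 : ℝ) + 1) * ‖v‖ * ‖(sym η p : Fock η ι)‖) *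
        (C * ((p.1 : ℝ) + 1) ^ m * ‖(sym η p : Fock η ι)‖)) :=
        mul_le_mul_of_nonneg_left h1 (weight_pos hy p).le
    _ = _ := by ring

theorem gibbsSum_creation_mul (e : HilbertBasis ι ℂ H) (hy : ∀ i, 0 < y i)
    (hw : Summable fun p : Conf ι => weight y p * ‖(sym η p : Fock η ι)‖ ^ 2)
    (i : ι) {X : Module.End ℂ (FinFock η ι)} (hX : X ∈ admissible η ι) :
    gibbsSum y (creation η e (e i) * X) = y i * gibbsSum y (X * creation η e (e i)) := by
  obtain ⟨hX1, X', -, hadj⟩ := mem_admissible.1 hX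
  refine tsum_weight_cyclic (weight y) (weight y) (y i) (A := creation η e (e i)) (X := X)
    (inner_annihilation e (e i)) hadj
    (fun p q hpq => ?_) ?_
  · rw [(weight_of_inner_creation_ne_zero e y i hpq).1, Complex.ofReal_mul]
  · simp only [abs_of_pos (weight_pos hy _)]
    exact summable_weight_norm_apply e hy hw (polyBounded_annihilation e _) hX1

theorem gibbsSum_annihilation_mul (e : HilbertBasis ι ℂ H) (hy : ∀ i, 0 < y i)
    (hw : Summable fun p : Conf ι => weight y p * ‖(sym η p : Fock η ι)‖ ^ 2)
    (i : ι) {X : Module.End ℂ (FinFock η ι)} (hX : X ∈ admissible η ι) :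
    gibbsSum y (annihilation η e (e i) * X) =
      (y i : ℂ)⁻¹ * gibbsSum y (X * annihilation η e (e i)) := by
  obtain ⟨hX1, X', -, hadj⟩ := mem_admissible.1 hX
  refine tsum_weight_cyclic (weight y) (weight y) (y i : ℂ)⁻¹ (A := annihilation η e (e i)) (X := X)
    (inner_creation e (e i)) hadj
    (fun p q hpq => ?_) ?_
  · rw [← inner_creation, ← inner_conj_symm] at hpq
    have h1 := (weight_of_inner_creation_ne_zero e y i
      fun h => hpq (by rw [h, map_zero])).1
    have h2 : (y i : ℂ) ≠ 0 := Complex.ofReal_ne_zero.2 (hy i).ne'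
    rw [h1, Complex.ofReal_mul, inv_mul_cancel_left₀ h2]
  · simp only [abs_of_pos (weight_pos hy _)]
    exact summable_weight_norm_apply e hy hw (polyBounded_creation e _) hX1

/-- The properties of the expectation in a Gaussian state used in the proof of Wick's theorem. The
expectation is extended arbitrarily to a linear functional `ω` on all operators; `y i` stands for
`exp (-ν i)`. -/
structure IsGaussianState (e : HilbertBasis ι ℂ H) (y : ι → ℝ)
    (ρ : Fock η ι →L[ℂ] Fock η ι) (ω : Module.End ℂ (FinFock η ι) →ₗ[ℂ] ℂ) : Prop where
  hasExpectation : ∀ O ∈ admissible η ι, HasExpectation ρ O (ω O)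
  map_one : ω 1 = 1
  creation_cyclic : ∀ i, ∀ X ∈ admissible η ι,
    ω (creation η e (e i) * X) = (y i : ℂ) * ω (X * creation η e (e i))
  annihilation_cyclic : ∀ i, ∀ X ∈ admissible η ι,
    ω (annihilation η e (e i) * X) = (y i : ℂ)⁻¹ * ω (X * annihilation η e (e i))
  creation_bound : ∀ X ∈ admissible η ι, ∃ C : ℝ, ∀ v, ‖ω (creation η e v * X)‖ ≤ C * ‖v‖
  annihilation_bound : ∀ X ∈ admissible η ι, ∃ C : ℝ, ∀ v, ‖ω (annihilation η e v * X)‖ ≤ C * ‖v‖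

/-- `ρ O` is the nuclear operator `Z⁻¹ ∑ p, weight p |sym p⟩⟨O† sym p|`. -/
theorem hasExpectation_of_mem_admissible (e : HilbertBasis ι ℂ H) {ν : ι → ℝ}
    {G : Fock η ι →L[ℂ] Fock η ι} (hG : IsExpNegNumber η e ν G) (Z : ℂ)
    (hw : Summable fun p : Conf ι => weight (fun i => Real.exp (-ν i)) p *
      ‖(sym η p : Fock η ι)‖ ^ 2)
    {O : Module.End ℂ (FinFock η ι)} (hO : O ∈ admissible η ι) :
    HasExpectation (Z⁻¹ • G) O (Z⁻¹ * gibbsSum (fun i => Real.exp (-ν i)) O) := by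
  set y : ι → ℝ := fun i => Real.exp (-ν i) with hydef
  have hy : ∀ i, 0 < y i := fun i => Real.exp_pos _
  obtain ⟨-, O', hO', hadj⟩ := mem_admissible.1 hO
  have h1 : PolyBounded (1 : Module.End ℂ (FinFock η ι)) := by
    simpa using PolyBounded.smul_one (η := η) (ι := ι) 1
  have hs : Summable fun p : Conf ι => ‖(O' (sym η p) : Fock η ι)‖ *
      ‖(Z⁻¹ * (weight y p : ℂ)) • (sym η p : Fock η ι)‖ := by
    refine ((summable_weight_norm_apply e hy hw hO' h1).mul_left ‖Z⁻¹‖).congr fun p => ?_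
    rw [norm_smul, norm_mul, Complex.norm_real, Real.norm_of_nonneg (weight_pos hy p).le]
    change _ * (_ * (_ * ‖(sym η p : Fock η ι)‖)) = _
    ring
  obtain ⟨T, hT⟩ := exists_nuclear (fun p : Conf ι => (Z⁻¹ * (weight y p : ℂ)) •
    (sym η p : Fock η ι)) (fun p => (O' (sym η p) : Fock η ι)) hs
  refine ⟨T, fun ψ => ?_, ?_⟩
  · refine (hT ψ).unique ?_
    refine ((hasSum_sym (O ψ : Fock η ι)).mapL (Z⁻¹ • G)).congr_fun fun p => ?_
    rw [map_smul]
    change _ = ((O ψ : Fock η ι) : FullFock ι) p • (Z⁻¹ • G (sym η p : Fock η ι))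
    rw [hG.apply_sym, ← inner_sym, hadj]
    simp only [smul_smul]
    rfl
  · have h2 := hasTrace_of_nuclear _ _ hs T hT
    have h3 : ∑' p : Conf ι, ⟪(O' (sym η p) : Fock η ι),
        (Z⁻¹ * (weight y p : ℂ)) • (sym η p : Fock η ι)⟫_ℂ = Z⁻¹ * gibbsSum y O := by
      rw [gibbsSum, ← tsum_mul_left]
      refine tsum_congr fun p => ?_
      rw [inner_smul_right_fock, hadj, mul_assoc]
    rw [← h3]
    exact h2

theorem exists_linearMap_eq_on {V : Type*} [AddCommGroup V] [Module ℂ V] (S : Submodule ℂ V)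
    (f : V → ℂ) (hadd : ∀ a ∈ S, ∀ b ∈ S, f (a + b) = f a + f b)
    (hsmul : ∀ (c : ℂ), ∀ a ∈ S, f (c • a) = c * f a) : ∃ ω : V →ₗ[ℂ] ℂ, ∀ a ∈ S, ω a = f a := by
  let φ : S →ₗ[ℂ] ℂ :=
    { toFun := fun a => f a
      map_add' := fun a b => hadd a a.2 b b.2
      map_smul' := fun c a => hsmul c a a.2 }
  obtain ⟨ω, hω⟩ := φ.exists_extend
  exact ⟨ω, fun a ha => congrArg (fun L : S →ₗ[ℂ] ℂ => L ⟨a, ha⟩) hω⟩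

/-- The Gaussian density matrix defines a Gaussian state. -/
theorem exists_isGaussianState (e : HilbertBasis ι ℂ H) {ν : ι → ℝ} {ρ : Fock η ι →L[ℂ] Fock η ι}
    (hρ : IsGaussianDensity η e ν ρ) :
    (Summable fun p : Conf ι => weight (fun i => Real.exp (-ν i)) p *
      ‖(sym η p : Fock η ι)‖ ^ 2) ∧ ∃ ω : Module.End ℂ (FinFock η ι) →ₗ[ℂ] ℂ,
      IsGaussianState e (fun i => Real.exp (-ν i)) ρ ω := by
  obtain ⟨G, Z, hG, hZ, rfl⟩ := hρ
  obtain ⟨z, rfl, hz⟩ := hG.hasSum_weight hZ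
  have hw := hz.summable
  have hE := fun O hO => hasExpectation_of_mem_admissible (O := O) e hG (z : ℂ) hw hO
  set y : ι → ℝ := fun i => Real.exp (-ν i) with hydef
  have hy : ∀ i, 0 < y i := fun i => Real.exp_pos _
  refine ⟨hw, ?_⟩
  have hz0 : 0 < z := by
    have h := hw.sum_le_tsum {(⟨0, Fin.elim0⟩ : Conf ι)} fun p _ =>
      mul_nonneg (weight_pos hy p).le (by positivity)
    -- The vacuum alone contributes `1`.
    rw [hz.tsum_eq, Finset.sum_singleton, norm_sym_of_le_one η _ (Nat.zero_le _)] at h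
    have h2 : weight y (⟨0, Fin.elim0⟩ : Conf ι) = 1 := by simp [weight]
    rw [h2] at h
    linarith
  have hzc : (z : ℂ) ≠ 0 := Complex.ofReal_ne_zero.2 hz0.ne'
  obtain ⟨ω, hωφ⟩ := exists_linearMap_eq_on (V := Module.End ℂ (FinFock η ι))
    (Subalgebra.toSubmodule (admissible η ι)) (fun O => (z : ℂ)⁻¹ * gibbsSum y O)
    (fun A hA B hB => by
      rw [gibbsSum_add e hy hw (mem_admissible.1 hA).1 (mem_admissible.1 hB).1, mul_add])
    (fun c A _ => by rw [gibbsSum_smul c A, mul_left_comm])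
  replace hωφ : ∀ O ∈ admissible η ι, ω O = (z : ℂ)⁻¹ * gibbsSum y O := hωφ
  have hcr := fun v => creation_mem_admissible (η := η) e v
  have han := fun v => annihilation_mem_admissible (η := η) e v
  have hbound : ∀ X ∈ admissible η ι, ∀ A : H → Module.End ℂ (FinFock η ι),
      (∀ v, A v ∈ admissible η ι) → (∃ C : ℝ, ∀ v, ‖gibbsSum y (A v * X)‖ ≤ C * ‖v‖) →
      ∃ C : ℝ, ∀ v, ‖ω (A v * X)‖ ≤ C * ‖v‖ := by
    rintro X hX A hA ⟨C, hC⟩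
    refine ⟨‖(z : ℂ)⁻¹‖ * C, fun v => ?_⟩
    rw [hωφ _ (mul_mem (hA v) hX), norm_mul, mul_assoc]
    exact mul_le_mul_of_nonneg_left (hC v) (norm_nonneg _)
  refine ⟨ω, fun O hO => ?_, ?_, fun i X hX => ?_, fun i X hX => ?_, fun X hX => ?_, fun X hX => ?_⟩
  · rw [hωφ O hO]
    exact hE O hO
  · rw [hωφ 1 (one_mem _), gibbsSum_one hz, inv_mul_cancel₀ hzc]
  · rw [hωφ _ (mul_mem (hcr _) hX), hωφ _ (mul_mem hX (hcr _)),
      gibbsSum_creation_mul e hy hw i hX, mul_left_comm]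
  · rw [hωφ _ (mul_mem (han _) hX), hωφ _ (mul_mem hX (han _)),
      gibbsSum_annihilation_mul e hy hw i hX, mul_left_comm]
  · refine hbound X hX _ hcr (exists_norm_gibbsSum_le e hy hw (mem_admissible.1 hX).1 (creation η e)
      (annihilation η e) (inner_annihilation e) fun v p => ?_)
    refine (norm_annihilation_le e v (particlesLE_sym p)).trans ?_
    gcongr
    linarith
  · exact hbound X hX _ han (exists_norm_gibbsSum_le e hy hw (mem_admissible.1 hX).1
      (annihilation η e) (creation η e) (inner_creation e) fun v p =>
        norm_creation_le e v (particlesLE_sym p))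

end State

/-! ### Wick's theorem in a Gaussian state -/

section Wick

variable {ι H : Type*} [NormedAddCommGroup H] [InnerProductSpace ℂ H] {η : ℤˣ} {y : ι → ℝ}

theorem creation_add (e : HilbertBasis ι ℂ H) (u v : H) :
    creation η e (u + v) = creation η e u + creation η e v := by
  refine LinearMap.ext fun f => ext_coord fun k x => ?_
  change _ = coord (creation η e u f) _ + coord (creation η e v f) _
  cases k with
  | zero => simp [coord_creation_zero]
  | succ k =>
    simp only [coord_creation_succ, inner_add_right, ← mul_add, ← Finset.sum_add_distrib]
    congr 1
    exact Finset.sum_congr rfl fun j _ => by ring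

theorem creation_smul (e : HilbertBasis ι ℂ H) (c : ℂ) (v : H) :
    creation η e (c • v) = c • creation η e v := by
  refine LinearMap.ext fun f => ext_coord fun k x => ?_
  change _ = c * coord (creation η e v f) _
  cases k with
  | zero => simp [coord_creation_zero]
  | succ k =>
    simp only [coord_creation_succ, inner_smul_right]
    rw [mul_left_comm c]
    congr 1
    rw [Finset.mul_sum]
    exact Finset.sum_congr rfl fun j _ => by ring

theorem annihilation_add (e : HilbertBasis ι ℂ H) (u v : H) :
    annihilation η e (u + v) = annihilation η e u + annihilation η e v := by
  refine LinearMap.ext fun f => ext_inner_finFock fun g => ?_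
  rw [inner_annihilation, creation_add]
  refine (inner_add_right (f : Fock η ι) (creation η e u g) (creation η e v g)).trans ?_
  rw [← inner_annihilation, ← inner_annihilation]
  exact (inner_add_left _ _ (g : Fock η ι)).symm

theorem annihilation_smul (e : HilbertBasis ι ℂ H) (c : ℂ) (v : H) :
    annihilation η e (c • v) = (starRingEnd ℂ) c • annihilation η e v := by
  refine LinearMap.ext fun f => ext_inner_finFock fun g => ?_
  rw [inner_annihilation, creation_smul]
  refine (inner_smul_right_fock (f : Fock η ι) (creation η e v g) c).trans ?_
  rw [← inner_annihilation]
  refine Eq.trans ?_ (inner_smul_left_fock _ (g : Fock η ι) _).symm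
  rw [Complex.conj_conj]

/-- A bounded additive function that is linear or antilinear vanishes if it vanishes on a Hilbert
basis. -/
theorem eq_zero_of_hilbertBasis (e : HilbertBasis ι ℂ H) (D : H → ℂ)
    (hadd : ∀ u v, D (u + v) = D u + D v) (hsmul : ∀ (c : ℂ) v, D v = 0 → D (c • v) = 0)
    (hb : ∃ C : ℝ, ∀ v, ‖D v‖ ≤ C * ‖v‖) (h0 : ∀ i, D (e i) = 0) (v : H) : D v = 0 := by
  obtain ⟨C, hC⟩ := hb
  have hz : D 0 = 0 := by
    have := hadd 0 0
    rw [add_zero] at this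
    simpa using this
  have hcont : Continuous D :=
    AddMonoidHomClass.continuous_of_bound
      ({ toFun := D, map_zero' := hz, map_add' := hadd } : H →+ ℂ) C hC
  let S : Submodule ℂ H :=
    { carrier := {v | D v = 0}
      add_mem' := fun {u v} hu hv => by
        change D u = 0 at hu
        change D v = 0 at hv
        change D (u + v) = 0
        rw [hadd, hu, hv, add_zero]
      zero_mem' := hz
      smul_mem' := fun c v hv => hsmul c v hv }
  have hS : IsClosed (S : Set H) := isClosed_eq hcont continuous_const
  have h1 : (Submodule.span ℂ (Set.range e)).topologicalClosure ≤ S :=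
    Submodule.topologicalClosure_minimal _
      (Submodule.span_le.2 (by rintro _ ⟨i, rfl⟩; exact h0 i)) hS
  rw [e.dense_span] at h1
  exact h1 (Submodule.mem_top (x := v))

theorem IsLadderCombination.mem_admissible {e : HilbertBasis ι ℂ H}
    {b : Module.End ℂ (FinFock η ι)} (hb : IsLadderCombination η e b) : b ∈ admissible η ι := by
  have h : Submodule.span ℂ (Set.range (creation η e) ∪ Set.range (annihilation η e)) ≤
      Subalgebra.toSubmodule (admissible η ι) := by
    rw [Submodule.span_le]
    rintro _ (⟨v, rfl⟩ | ⟨v, rfl⟩)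
    · exact creation_mem_admissible e v
    · exact annihilation_mem_admissible e v
  exact h hb

theorem isLadderCombination_creation (e : HilbertBasis ι ℂ H) (v : H) :
    IsLadderCombination η e (creation η e v) :=
  Submodule.subset_span (Or.inl ⟨v, rfl⟩)

theorem list_prod_mem_admissible {e : HilbertBasis ι ℂ H} {n : ℕ}
    {b : Fin n → Module.End ℂ (FinFock η ι)} (hb : ∀ j, IsLadderCombination η e (b j)) :
    (List.ofFn b).prod ∈ admissible η ι := by
  refine list_prod_mem fun x hx => ?_
  obtain ⟨j, rfl⟩ := (List.mem_ofFn' b x).1 hx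
  exact (hb j).mem_admissible

/-- A scalar (anti)commutator with the ladder operators extends to their linear combinations. -/
theorem exists_commutator_of_span {e : HilbertBasis ι ℂ H} (c : Module.End ℂ (FinFock η ι))
    (hcr : ∀ v, ∃ s : ℂ, creation η e v * c = eta η • (c * creation η e v) + s • 1)
    (han : ∀ v, ∃ s : ℂ, annihilation η e v * c = eta η • (c * annihilation η e v) + s • 1)
    {b : Module.End ℂ (FinFock η ι)} (hb : IsLadderCombination η e b) :
    ∃ s : ℂ, b * c = eta η • (c * b) + s • 1 := by
  induction hb using Submodule.span_induction with
  | mem x hx =>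
    rcases hx with ⟨v, rfl⟩ | ⟨v, rfl⟩
    · exact hcr v
    · exact han v
  | zero => exact ⟨0, by simp⟩
  | add x x' _ _ hx hx' =>
    obtain ⟨s, hs⟩ := hx
    obtain ⟨s', hs'⟩ := hx'
    refine ⟨s + s', ?_⟩
    rw [add_mul, mul_add, hs, hs', smul_add, add_smul]
    abel
  | smul t x _ hx =>
    obtain ⟨s, hs⟩ := hx
    refine ⟨t * s, ?_⟩
    rw [smul_mul_assoc, hs, mul_smul_comm, smul_add, smul_smul t s, smul_comm t (eta η)]

theorem exists_commutator_creation (e : HilbertBasis ι ℂ H) (i : ι)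
    {b : Module.End ℂ (FinFock η ι)} (hb : IsLadderCombination η e b) :
    ∃ s : ℂ, b * creation η e (e i) = eta η • (creation η e (e i) * b) + s • 1 :=
  exists_commutator_of_span _
    (fun v => ⟨0, by rw [creation_mul_creation_basis, zero_smul, add_zero]⟩)
    (fun v => ⟨_, annihilation_mul_creation e v (e i)⟩) hb

theorem exists_commutator_annihilation (e : HilbertBasis ι ℂ H) (i : ι)
    {b : Module.End ℂ (FinFock η ι)} (hb : IsLadderCombination η e b) :
    ∃ s : ℂ, b * annihilation η e (e i) = eta η • (annihilation η e (e i) * b) + s • 1 := by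
  refine exists_commutator_of_span _ (fun v => ⟨-(eta η * ⟪e i, v⟫_ℂ), ?_⟩)
    (fun v => ⟨0, by rw [annihilation_mul_annihilation_basis, zero_smul, add_zero]⟩) hb
  rw [annihilation_mul_creation, smul_add, smul_smul, smul_smul, eta_mul_self, one_smul, add_assoc,
    ← add_smul, add_neg_cancel, zero_smul, add_zero]

/-- The difference of the two sides of `WickRecursion`, as a linear functional of the first
operator. -/
def wickDefect {R : Type*} [Ring R] [Algebra ℂ R] (η : ℤˣ) (ω : R →ₗ[ℂ] ℂ) {n : ℕ}
    (b : Fin (n + 1) → R) : R →ₗ[ℂ] ℂ :=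
  ω ∘ₗ LinearMap.mulRight ℂ (List.ofFn b).prod - ∑ j : Fin (n + 1),
    (eta η ^ (j : ℕ) * ω (List.ofFn (b ∘ j.succAbove)).prod) • (ω ∘ₗ LinearMap.mulRight ℂ (b j))

theorem wickDefect_apply {R : Type*} [Ring R] [Algebra ℂ R] (η : ℤˣ) (ω : R →ₗ[ℂ] ℂ) {n : ℕ}
    (b : Fin (n + 1) → R) (c : R) : wickDefect η ω b c = ω (c * (List.ofFn b).prod) -
      ∑ j : Fin (n + 1),
        (eta η ^ (j : ℕ) * ω (List.ofFn (b ∘ j.succAbove)).prod) * ω (c * b j) := by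
  simp only [wickDefect, LinearMap.sub_apply, LinearMap.comp_apply, LinearMap.mulRight_apply,
    LinearMap.sum_apply, LinearMap.smul_apply, smul_eq_mul]

theorem wickDefect_eq_zero_iff {R : Type*} [Ring R] [Algebra ℂ R] (η : ℤˣ) (ω : R →ₗ[ℂ] ℂ) {n : ℕ}
    (b : Fin (n + 1) → R) (c : R) : wickDefect η ω b c = 0 ↔ WickRecursion η ω c b := by
  rw [wickDefect_apply, sub_eq_zero, WickRecursion]
  have : ∀ j : Fin (n + 1), eta η ^ (j : ℕ) * ω (List.ofFn (b ∘ j.succAbove)).prod * ω (c * b j) =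
      eta η ^ (j : ℕ) * ω (c * b j) * ω (List.ofFn (b ∘ j.succAbove)).prod := fun j => by ring
  simp only [this]

/-- The factor `1 - η y i` (the inverse of `1 + η n_i`, with `n_i` the mean occupation) does not
vanish: for bosons because `y i < 1`. -/
theorem one_sub_eta_mul_ne_zero (hy : ∀ i, 0 < y i)
    (hw : Summable fun p : Conf ι => weight y p * ‖(sym η p : Fock η ι)‖ ^ 2) (i : ι) :
    1 - eta η * (y i : ℂ) ≠ 0 := by
  rcases Int.units_eq_one_or η with rfl | rfl
  · have h := (le_abs_self _).trans_lt (lt_one_of_summable_weight hw i)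
    have : (1 : ℝ) - y i ≠ 0 := by linarith
    simpa [eta] using (by exact_mod_cast this : (1 : ℂ) - y i ≠ 0)
  · have h := hy i
    have : (1 : ℝ) + y i ≠ 0 := by linarith
    simpa [eta] using (by exact_mod_cast this : (1 : ℂ) + y i ≠ 0)

theorem one_sub_eta_mul_inv_ne_zero (hy : ∀ i, 0 < y i)
    (hw : Summable fun p : Conf ι => weight y p * ‖(sym η p : Fock η ι)‖ ^ 2) (i : ι) :
    1 - eta η * (y i : ℂ)⁻¹ ≠ 0 := by
  intro h
  have h0 : (y i : ℂ) ≠ 0 := Complex.ofReal_ne_zero.2 (hy i).ne'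
  have h1 : (y i : ℂ) = eta η := by
    field_simp at h
    linear_combination h
  refine one_sub_eta_mul_ne_zero hy hw i ?_
  rw [h1, eta_mul_self, sub_self]

/-- The defect inherits boundedness in the parameter of its argument from the functional. -/
theorem exists_norm_wickDefect_le {V : Type*} [NormedAddCommGroup V]
    (ω : Module.End ℂ (FinFock η ι) →ₗ[ℂ] ℂ)
    (A : V → Module.End ℂ (FinFock η ι))
    (hA : ∀ X ∈ admissible η ι, ∃ C : ℝ, ∀ v, ‖ω (A v * X)‖ ≤ C * ‖v‖) {n : ℕ}
    (b : Fin (n + 1) → Module.End ℂ (FinFock η ι)) (hb : ∀ j, b j ∈ admissible η ι) :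
    ∃ C : ℝ, ∀ v, ‖wickDefect η ω b (A v)‖ ≤ C * ‖v‖ := by
  have hprod : (List.ofFn b).prod ∈ admissible η ι := by
    refine list_prod_mem fun x hx => ?_
    obtain ⟨j, rfl⟩ := (List.mem_ofFn' b x).1 hx
    exact hb j
  obtain ⟨C, hC⟩ := hA _ hprod
  choose D hD using fun j => hA _ (hb j)
  refine ⟨C + ∑ j : Fin (n + 1),
    ‖eta η ^ (j : ℕ) * ω (List.ofFn (b ∘ j.succAbove)).prod‖ * D j, fun v => ?_⟩
  rw [wickDefect_apply, add_mul, Finset.sum_mul]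
  refine (norm_sub_le _ _).trans (add_le_add (hC v) ((norm_sum_le _ _).trans
    (Finset.sum_le_sum fun j _ => ?_)))
  rw [norm_mul, mul_assoc]
  exact mul_le_mul_of_nonneg_left (hD j v) (norm_nonneg _)

variable {e : HilbertBasis ι ℂ H} {ρ : Fock η ι →L[ℂ] Fock η ι}
  {ω : Module.End ℂ (FinFock η ι) →ₗ[ℂ] ℂ}

/-- Wick's recursion in a Gaussian state. It holds for `a†(e i)` and `a(e i)` by cyclicity, for
`a†(v)` and `a(v)` by continuity in `v`, and for their linear combinations by linearity. -/
theorem IsGaussianState.wickRecursion (hω : IsGaussianState e y ρ ω) (hy : ∀ i, 0 < y i)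
    (hw : Summable fun p : Conf ι => weight y p * ‖(sym η p : Fock η ι)‖ ^ 2) {n : ℕ} (hn : Even n)
    {c : Module.End ℂ (FinFock η ι)} (hc : IsLadderCombination η e c)
    {b : Fin (n + 1) → Module.End ℂ (FinFock η ι)} (hb : ∀ j, IsLadderCombination η e (b j)) :
    WickRecursion η ω c b := by
  have hprod := list_prod_mem_admissible hb
  have hcr : ∀ v, wickDefect η ω b (creation η e v) = 0 := by
    refine eq_zero_of_hilbertBasis e (fun v => wickDefect η ω b (creation η e v))
      (fun u v => by rw [creation_add, map_add])
      (fun t v h => by rw [creation_smul, map_smul, h, smul_zero])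
      (exists_norm_wickDefect_le ω _ hω.creation_bound b fun j => (hb j).mem_admissible) fun i => ?_
    choose s hs using fun j => exists_commutator_creation e i (hb j)
    exact (wickDefect_eq_zero_iff η ω b _).2 (wickRecursion_of_cyclic η ω hω.map_one hn _ b s hs
      (y i) (one_sub_eta_mul_ne_zero hy hw i) (hω.creation_cyclic i _ hprod)
      fun j => hω.creation_cyclic i _ (hb j).mem_admissible)
  have han : ∀ v, wickDefect η ω b (annihilation η e v) = 0 := by
    refine eq_zero_of_hilbertBasis e (fun v => wickDefect η ω b (annihilation η e v))
      (fun u v => by rw [annihilation_add, map_add])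
      (fun t v h => by rw [annihilation_smul, map_smul, h, smul_zero])
      (exists_norm_wickDefect_le ω _ hω.annihilation_bound b fun j => (hb j).mem_admissible)
      fun i => ?_
    choose s hs using fun j => exists_commutator_annihilation e i (hb j)
    exact (wickDefect_eq_zero_iff η ω b _).2 (wickRecursion_of_cyclic η ω hω.map_one hn _ b s hs
      (y i : ℂ)⁻¹ (one_sub_eta_mul_inv_ne_zero hy hw i) (hω.annihilation_cyclic i _ hprod)
      fun j => hω.annihilation_cyclic i _ (hb j).mem_admissible)
  refine (wickDefect_eq_zero_iff η ω b c).1 ?_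
  induction hc using Submodule.span_induction with
  | mem x hx =>
    rcases hx with ⟨v, rfl⟩ | ⟨v, rfl⟩
    · exact hcr v
    · exact han v
  | zero => exact map_zero _
  | add x x' _ _ hx hx' => rw [map_add, hx, hx', add_zero]
  | smul t x _ hx => rw [map_smul, hx, smul_zero]

/-- By cyclicity, `ω (a†_i a†(u')) = η y i ω (a†_i a†(u'))`, and `η y i ≠ 1`. -/
theorem IsGaussianState.creation_mul_creation_eq_zero (hω : IsGaussianState e y ρ ω)
    (hy : ∀ i, 0 < y i)
    (hw : Summable fun p : Conf ι => weight y p * ‖(sym η p : Fock η ι)‖ ^ 2) (u u' : H) :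
    ω (creation η e u * creation η e u') = 0 := by
  refine eq_zero_of_hilbertBasis e (fun u => ω (creation η e u * creation η e u'))
    (fun u v => by rw [creation_add, add_mul, map_add])
    (fun t v h => by rw [creation_smul, smul_mul_assoc, map_smul, h, smul_zero])
    (hω.creation_bound _ (creation_mem_admissible e u')) (fun i => ?_) u
  have h := hω.creation_cyclic i _ (creation_mem_admissible e u')
  rw [creation_mul_creation_basis, map_smul, smul_eq_mul] at h
  refine (mul_eq_zero.1 ?_).resolve_left (one_sub_eta_mul_ne_zero hy hw i)
  linear_combination h

theorem annihilation_mul_creation_of_inner_eq_zero (e : HilbertBasis ι ℂ H) {u v : H}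
    (h : ⟪u, v⟫_ℂ = 0) :
    annihilation η e u * creation η e v = eta η • (creation η e v * annihilation η e u) := by
  rw [annihilation_mul_creation, h, zero_smul, add_zero]

/-- Normal ordering of a product of factors `u i * w i` whose different factors (anti)commute. -/
theorem prod_mul_eq_normal_ordered {R : Type*} [Ring R] [Algebra ℂ R] (η : ℤˣ) :
    ∀ {n : ℕ} (u w : Fin n → R), (∀ i j, i ≠ j → w i * u j = eta η • (u j * w i)) →
      (List.ofFn fun i => u i * w i).prod =
        eta η ^ n.choose 2 • ((List.ofFn u).prod * (List.ofFn w).prod) := by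
  have hmove : ∀ {n : ℕ} (u : Fin n → R) (c : R), (∀ j, c * u j = eta η • (u j * c)) →
      c * (List.ofFn u).prod = eta η ^ n • ((List.ofFn u).prod * c) := by
    intro n
    induction n with
    | zero => intro u c _; simp
    | succ n ih =>
      intro u c h
      rw [List.ofFn_succ, List.prod_cons, ← mul_assoc, h 0, smul_mul_assoc, mul_assoc,
        ih (fun i => u i.succ) c fun j => h j.succ, mul_smul_comm, smul_smul, pow_succ', mul_assoc]
  intro n
  induction n with
  | zero => intro u w _; simp
  | succ n ih =>
    intro u w h
    rw [List.ofFn_succ, List.prod_cons, ih (fun i => u i.succ) (fun i => w i.succ)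
      (fun i j hij => h _ _ (by simpa using hij)), List.ofFn_succ, List.prod_cons, List.ofFn_succ,
      List.prod_cons, mul_smul_comm, Nat.choose_succ_succ, Nat.choose_one_right, pow_add]
    have h1 := hmove (fun i => u i.succ) (w 0) fun j => h 0 j.succ (Fin.succ_ne_zero j).symm
    rw [mul_assoc (u 0), ← mul_assoc (w 0), h1, smul_mul_assoc, mul_smul_comm, smul_smul,
      mul_comm (eta η ^ n)]
    simp only [mul_assoc]

end Wick

end WickFock

end

/-- Wick's theorem for the Gaussian density matrix `Z⁻¹ exp (-∑ i, ν i a†_i a_i)` on the bosonic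
(`η = 1`) or fermionic (`η = -1`) Fock space over `H`, and the formula for `⟨N_1 ⋯ N_k⟩`. -/
theorem theorem1 {ι H : Type*} [NormedAddCommGroup H] [InnerProductSpace ℂ H] [CompleteSpace H]
    (e : HilbertBasis ι ℂ H) (η : ℤˣ) (ν : ι → ℝ)
    (ρ : WickFock.Fock η ι →L[ℂ] WickFock.Fock η ι)
    (hρ : WickFock.IsGaussianDensity η e ν ρ) :
    (∀ (k : ℕ) (b : Fin (2 * k) → Module.End ℂ (WickFock.FinFock η ι)),
      (∀ j, WickFock.IsLadderCombination η e (b j)) →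
      (∀ i j, WickFock.HasExpectation ρ (b i * b j) (WickFock.expectation ρ (b i * b j))) ∧
      WickFock.HasExpectation ρ (List.ofFn b).prod
        (∑ σ ∈ WickFock.contractions k, WickFock.statSign η σ *
          ∏ i : Fin k, WickFock.expectation ρ
            (b (σ (WickFock.pairFst i)) * b (σ (WickFock.pairSnd i))))) ∧
    (∀ (k : ℕ) (v : Fin k → H), Orthonormal ℂ v →
      WickFock.HasExpectation ρ
        (List.ofFn fun i =>
          WickFock.creation η e (v i) * WickFock.annihilation η e (v i)).prod
        (if η = 1 then
          (Matrix.of fun i j => WickFock.expectation ρ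
            (WickFock.creation η e (v i) * WickFock.annihilation η e (v j))).permanent
        else
          (Matrix.of fun i j => WickFock.expectation ρ
            (WickFock.creation η e (v i) * WickFock.annihilation η e (v j))).det)) := by
  obtain ⟨hw, ω, hω⟩ := WickFock.exists_isGaussianState e hρ
  have hy : ∀ i, 0 < Real.exp (-ν i) := fun i => Real.exp_pos _
  have hexp : ∀ O ∈ WickFock.admissible η ι, WickFock.expectation ρ O = ω O := fun O hO =>
    (hω.hasExpectation O hO).expectation_eq
  refine ⟨fun k b hb => ⟨fun i j => ?_, ?_⟩, fun k v hv => ?_⟩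
  · have hmem := mul_mem (hb i).mem_admissible (hb j).mem_admissible
    rw [hexp _ hmem]
    exact hω.hasExpectation _ hmem
  · have h := WickFock.wick_of_recursion η ω hω.map_one
      {c | WickFock.IsLadderCombination η e c}
      (fun n hn c hc b hb => hω.wickRecursion hy hw hn hc hb) k b hb
    have h2 : ∀ i j, WickFock.expectation ρ (b i * b j) = ω (b i * b j) := fun i j =>
      hexp _ (mul_mem (hb i).mem_admissible (hb j).mem_admissible)
    simp only [h2]
    have h3 := hω.hasExpectation _ (WickFock.list_prod_mem_admissible hb)
    rw [h] at h3
    exact h3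
  · have h2 : ∀ i j, WickFock.expectation ρ
        (WickFock.creation η e (v i) * WickFock.annihilation η e (v j)) =
        ω (WickFock.creation η e (v i) * WickFock.annihilation η e (v j)) := fun i j =>
      hexp _ (mul_mem (WickFock.creation_mem_admissible e _)
        (WickFock.annihilation_mem_admissible e _))
    have hmem : (List.ofFn fun i =>
        WickFock.creation η e (v i) * WickFock.annihilation η e (v i)).prod ∈
        WickFock.admissible η ι := by
      refine list_prod_mem fun x hx => ?_
      obtain ⟨j, rfl⟩ := (List.mem_ofFn' _ x).1 hx
      exact mul_mem (WickFock.creation_mem_admissible e _)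
        (WickFock.annihilation_mem_admissible e _)
    have h3 := WickFock.normal_ordered_of_recursion η ω hω.map_one
      (Set.range (WickFock.creation η e)) (Set.range (WickFock.annihilation η e))
      (by
        rintro n hn _ ⟨u, rfl⟩ b hb
        refine hω.wickRecursion hy hw hn (WickFock.isLadderCombination_creation e u) fun j => ?_
        exact Submodule.subset_span (hb j))
      (by
        rintro _ ⟨u, rfl⟩ _ ⟨u', rfl⟩
        exact hω.creation_mul_creation_eq_zero hy hw u u')
      k (fun i => WickFock.creation η e (v i)) (fun i => WickFock.annihilation η e (v i))
      (fun i => ⟨_, rfl⟩) (fun i => ⟨_, rfl⟩)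
    have h4 := WickFock.prod_mul_eq_normal_ordered η (fun i => WickFock.creation η e (v i))
      (fun i => WickFock.annihilation η e (v i)) (fun i j hij =>
        WickFock.annihilation_mul_creation_of_inner_eq_zero e (hv.2 hij))
    have h5 := hω.hasExpectation _ hmem
    rw [h4, map_smul, h3, smul_eq_mul, ← mul_assoc, ← mul_pow, WickFock.eta_mul_self, one_pow,
      one_mul, WickFock.etaDet_eq_permanent_or_det, ← h4] at h5
    simp only [h2]
    exact h5
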